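/- Let $n\ge 1$, let $\Omega\subset\mathbb R^n$ be a bounded open set (in particular, a bounded domain), and let $0<\sigma<2$, $\Lambda>0$, $\gamma>0$. Write $B_r(y)$ for open balls, $B_r=B_r(0)$, and $|S|$ for Lebesgue measure. **Domain.** $\Omega$ satisfies the uniform exterior ball condition: there are $r_\Omega>0$ and, for all $x\in\partial\Omega$ and $0<r\le r_\Omega$, a point $y_x^r\in\Omega^c$ with $\overline B_r(y_x^r)\cap\overline\Omega=\{x\}$. Fix such points. **Problem.** Let $\mathcal A,\mathcal B$ be nonempty index sets, $g:\mathbb R^n\to\mathbb R$ bounded and continuous, and consider $$\sup_{a\in\mathcal A}\inf_{b\in\mathcal B}\{-I_{ab}[x,u]+b_{ab}(x)\cdot\nabla u(x)+c_{ab}(x)u(x)+f_{ab}(x)\}=0\ \text{ in }\Omega,\qquad u=g\ \text{ in }\Omega^c,\tag{1}$$ where $I_{ab}[x,u]=\int_{\mathbb R^n}\delta_zu(x)K_{ab}(x,z)\,dz$ and $\delta_zu(x)$ equals $u(x+z)-u(x)$ if $\sigma<1$, $u(x+z)-u(x)-\mathbf 1_{B_1}(z)\nabla u(x)\cdot z$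 if $\sigma=1$, and $u(x+z)-u(x)-\nabla u(x)\cdot z$ if $\sigma>1$. **Coefficients.** Assume $c_{ab}\ge\gamma$ in $\Omega$ for all $a,b$, and $b_{ab}\equiv0$ in $\Omega$ if $\sigma<1$. The families $\{b_{ab}\},\{c_{ab}\},\{f_{ab}\}$ are bounded on $\Omega$ uniformly in $a,b$ and equicontinuous at each point of $\Omega$ (continuous in $\Omega$, uniformly in $a,b$). For each $z\ne0$ the family $\{K_{ab}(\cdot,z)\}_{a,b}$ is equicontinuous at each point of $\Omega$, and for all $0<s<R$ the kernels $K_{ab}(x,z)$ are bounded uniformly in $a$, $b$, $x\in\Omega$ and $s\le|z|\le R$. **Kernels.** For all $a,b$ and $x\in\Omega$, the function $K=K_{ab}(x,\cdot)$ is measurable and satisfies * (H0) $K\ge0$; * (H1) $\int_{B_{2\delta}\setminus B_\delta}K(z)\,dz\le(2-\sigma)\Lambda\delta^{-\sigma}$ for all $\delta>0$; * (H2) $\left|\int_{B_{2\delta}\setminus B_\delta}zK(z)\,dz\right|\le\Lambda|1-\sigma|\delta^{1-\sigma}$ for all $\delta>0$. Moreover * ($\overline{\rm H3}$) there are $C>0$,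 $0<r_1<r_\Omega$, $\lambda>0$, $\mu>0$ such that for all $a,b$, all $x\in\partial\Omega$, $0<r<r_1$ and $w\in\Omega\cap B_{2r}(y_x^r)$, with $d=|w-y_x^r|-r$ and $\nu=(w-y_x^r)/|w-y_x^r|$, there is a measurable set $S\subset\{z: z\cdot\nu<-d\}\cap(B_{Cd}\setminus B_d)$ with $|S|\ge\mu|B_d|$ and $K_{ab}(w,z)\ge(2-\sigma)\lambda d^{-n-\sigma}$ for all $z\in S$. **Conclusion.** Problem (1) admits a discontinuous viscosity solution. That is, there is a bounded $u:\mathbb R^n\to\mathbb R$ whose upper and lower semicontinuous envelopes on $\mathbb R^n$, $$u^*(x)=\lim_{r\to0}\sup_{|y-x|\le r}u(y),\qquad u_*(x)=\lim_{r\to0}\inf_{|y-x|\le r}u(y),$$ satisfy $u^*\le g\le u_*$ in $\Omega^c$ and the following, where for $x\in\Omega$, $r\in\mathbb R$ and bounded $\varphi\in C^2(\mathbb R^n)$ we put $$I(x,r,\varphi)=\sup_{a}\inf_{b}\{-I_{ab}[x,\varphi]+b_{ab}(x)\cdot\nabla\varphi(x)+c_{ab}(x)r+f_{ab}(x)\}.$$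 If $\varphi\in C^2(\mathbb R^n)$ is bounded and $u^*-\varphi$ has a maximum over $\mathbb R^n$ at $x\in\Omega$, then $I(x,u^*(x),\varphi)\le0$; if $u_*-\varphi$ has a minimum over $\mathbb R^n$ at $x\in\Omega$, then $I(x,u_*(x),\varphi)\ge0$. -/

import Mathlib

open MeasureTheory Metric Set Filter Topology

noncomputable section

namespace NonlocalIsaacs

/-- The Euclidean space `ℝⁿ`. -/
abbrev E (n : ℕ) : Type := EuclideanSpace ℝ (Fin n)

/-- `u` is a bounded function on `ℝⁿ`. -/
def BoundedFun {n : ℕ} (u : E n → ℝ) : Prop := ∃ M : ℝ, ∀ x, |u x| ≤ M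

/-! ### The Lévy operators and the Bellman–Isaacs operator -/

/-- The compensated increment `δ_z φ(x)`. Here `fderiv ℝ φ x z` is `∇φ(x) · z`. -/
def increment {n : ℕ} (σ : ℝ) (φ : E n → ℝ) (x z : E n) : ℝ :=
  if σ < 1 then φ (x + z) - φ x
  else if σ = 1 then φ (x + z) - φ x - (ball (0 : E n) 1).indicator (fun w => fderiv ℝ φ x w) z
  else φ (x + z) - φ x - fderiv ℝ φ x z

/-- `∫ δ_z φ(x) k(z) dz`, where `k` is the kernel at the point `x`. -/
def levyOp {n : ℕ} (σ : ℝ) (k : E n → ℝ) (φ : E n → ℝ) (x : E n) : ℝ :=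
  ∫ z, increment σ φ x z * k z

/-- The operator
`I(x, r, φ) = sup_a inf_b { -I_ab[x, φ] + b_ab(x) · ∇φ(x) + c_ab(x) r + f_ab(x) }`. -/
def isaacsOp {n : ℕ} {A B : Type*} (σ : ℝ) (K : A → B → E n → E n → ℝ)
    (b : A → B → E n → E n) (c f : A → B → E n → ℝ)
    (x : E n) (r : ℝ) (φ : E n → ℝ) : ℝ :=
  ⨆ α : A, ⨅ β : B,
    (-levyOp σ (K α β x) φ x + fderiv ℝ φ x (b α β x) + c α β x * r + f α β x)

/-! ### Viscosity solutions of `I(x, u(x), u) = 0` in `Ω`, `u = g` in `Ωᶜ` -/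

/-- Bounded upper semicontinuous viscosity subsolutions of `I = 0` in `Ω`. The test functions are
the bounded `C²` functions on `ℝⁿ`; maxima are over the whole of `ℝⁿ`. -/
def IsViscositySubsolution {n : ℕ} (I : E n → ℝ → (E n → ℝ) → ℝ) (Ω : Set (E n))
    (u : E n → ℝ) : Prop :=
  BoundedFun u ∧ UpperSemicontinuous u ∧
    ∀ φ : E n → ℝ, ContDiff ℝ 2 φ → BoundedFun φ → ∀ x ∈ Ω,
      (∀ y, u y - φ y ≤ u x - φ x) → I x (u x) φ ≤ 0

/-- Bounded lower semicontinuous viscosity supersolutions of `I = 0` in `Ω`. -/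
def IsViscositySupersolution {n : ℕ} (I : E n → ℝ → (E n → ℝ) → ℝ) (Ω : Set (E n))
    (u : E n → ℝ) : Prop :=
  BoundedFun u ∧ LowerSemicontinuous u ∧
    ∀ φ : E n → ℝ, ContDiff ℝ 2 φ → BoundedFun φ → ∀ x ∈ Ω,
      (∀ y, u x - φ x ≤ u y - φ y) → 0 ≤ I x (u x) φ

/-- Viscosity subsolutions of the Dirichlet problem with exterior datum `g`. -/
def IsDirichletSubsolution {n : ℕ} (I : E n → ℝ → (E n → ℝ) → ℝ) (Ω : Set (E n))
    (g u : E n → ℝ) : Prop :=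
  IsViscositySubsolution I Ω u ∧ ∀ x ∈ Ωᶜ, u x ≤ g x

/-- Viscosity supersolutions of the Dirichlet problem with exterior datum `g`. -/
def IsDirichletSupersolution {n : ℕ} (I : E n → ℝ → (E n → ℝ) → ℝ) (Ω : Set (E n))
    (g u : E n → ℝ) : Prop :=
  IsViscositySupersolution I Ω u ∧ ∀ x ∈ Ωᶜ, g x ≤ u x

/-- Upper semicontinuous envelope on `ℝⁿ`: `𝓝 x` has the basis of closed balls `|y - x| ≤ r`
(centre included), so for a bounded `u` this is `lim_{r → 0} sup {u y : |y - x| ≤ r}`. -/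
def upperEnvelope {n : ℕ} (u : E n → ℝ) (x : E n) : ℝ := limsup u (𝓝 x)

/-- Lower semicontinuous envelope on `ℝⁿ`. -/
def lowerEnvelope {n : ℕ} (u : E n → ℝ) (x : E n) : ℝ := liminf u (𝓝 x)

/-- Discontinuous viscosity solutions of the Dirichlet problem: `u` is bounded, `u^*` is a
viscosity subsolution and `u_*` a viscosity supersolution of the Dirichlet problem. -/
def IsDiscontinuousViscositySolution {n : ℕ} (I : E n → ℝ → (E n → ℝ) → ℝ) (Ω : Set (E n))
    (g u : E n → ℝ) : Prop :=
  BoundedFun u ∧ IsDirichletSubsolution I Ω g (upperEnvelope u) ∧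
    IsDirichletSupersolution I Ω g (lowerEnvelope u)

/-! ### Assumptions on the domain and on the kernels -/

/-- Uniform exterior ball condition with radius `ρ`, witnessed by the centres `y x r`
(`x ∈ ∂Ω`, `0 < r ≤ ρ`). -/
def ExteriorBalls {n : ℕ} (Ω : Set (E n)) (ρ : ℝ) (y : E n → ℝ → E n) : Prop :=
  ∀ x ∈ frontier Ω, ∀ r : ℝ, 0 < r → r ≤ ρ →
    y x r ∈ Ωᶜ ∧ closedBall (y x r) r ∩ closure Ω = {x}

/-- The dyadic annulus `B_{2δ} \ B_δ`. -/
def annulus (n : ℕ) (δ : ℝ) : Set (E n) := ball 0 (2 * δ) \ ball 0 δ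

/-- Nonnegative measurable kernels `k` with the two integral bounds of order `σ` on annuli. -/
structure IsKernel {n : ℕ} (σ Λ : ℝ) (k : E n → ℝ) : Prop where
  measurable : Measurable k
  nonneg : ∀ z, 0 ≤ k z
  mass_le : ∀ δ : ℝ, 0 < δ →
    ∫⁻ z in annulus n δ, ENNReal.ofReal (k z) ≤ ENNReal.ofReal ((2 - σ) * Λ * δ ^ (-σ))
  moment_le : ∀ δ : ℝ, 0 < δ →
    ‖∫ z in annulus n δ, k z • z‖ ≤ Λ * |1 - σ| * δ ^ (1 - σ)

/-- Non-degeneracy of the kernels in the outer normal directions near the boundary.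
For `w ∈ Ω ∩ B_{2r}(y x r)` the number `d = |w - y x r| - r > 0` is the distance from `w` to the
exterior ball, and `ν = (w - y x r) / |w - y x r|`. The constants are uniform in all the other
data, while the set `S` may depend on all of them. -/
def BoundaryNondegenerate {n : ℕ} {A B : Type*} (σ : ℝ) (Ω : Set (E n)) (ρ : ℝ)
    (y : E n → ℝ → E n) (K : A → B → E n → E n → ℝ) : Prop :=
  ∃ C r₁ lam μ : ℝ, 0 < C ∧ 0 < r₁ ∧ r₁ < ρ ∧ 0 < lam ∧ 0 < μ ∧
    ∀ (α : A) (β : B), ∀ x ∈ frontier Ω, ∀ r : ℝ, 0 < r → r < r₁ →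
      ∀ w ∈ Ω ∩ ball (y x r) (2 * r),
        let d : ℝ := ‖w - y x r‖ - r
        let ν : E n := ‖w - y x r‖⁻¹ • (w - y x r)
        ∃ S : Set (E n), MeasurableSet S ∧
          S ⊆ {z | inner ℝ z ν < -d} ∩ (ball 0 (C * d) \ ball 0 d) ∧
          ENNReal.ofReal μ * volume (ball (0 : E n) d) ≤ volume S ∧
          ∀ z ∈ S, (2 - σ) * lam * d ^ (-(n : ℝ) - σ) ≤ K α β w z

end NonlocalIsaacs

end

open NonlocalIsaacs

namespace NonlocalIsaacs

/-! ### Semicontinuous envelopes -/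

section Envelopes

variable {n : ℕ} {u v : E n → ℝ} {M : ℝ}

lemma isBoundedUnder_le_of_abs_le (h : ∀ x, |u x| ≤ M) (l : Filter (E n)) :
    l.IsBoundedUnder (· ≤ ·) u :=
  ⟨M, eventually_map.2 (Eventually.of_forall fun x => (abs_le.1 (h x)).2)⟩

lemma isBoundedUnder_ge_of_abs_le (h : ∀ x, |u x| ≤ M) (l : Filter (E n)) :
    l.IsBoundedUnder (· ≥ ·) u :=
  ⟨-M, eventually_map.2 (Eventually.of_forall fun x => (abs_le.1 (h x)).1)⟩

lemma le_upperEnvelope (h : ∀ x, |u x| ≤ M) (x : E n) : u x ≤ upperEnvelope u x := by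
  by_contra! hlt
  exact lt_irrefl _
    (eventually_lt_of_limsup_lt hlt (isBoundedUnder_le_of_abs_le h _)).self_of_nhds

lemma upperEnvelope_le_of_eventually_le (h : ∀ x, |u x| ≤ M) {x : E n} {a : ℝ}
    (ha : ∀ᶠ y in 𝓝 x, u y ≤ a) : upperEnvelope u x ≤ a :=
  limsup_le_of_le (isBoundedUnder_ge_of_abs_le h _).isCoboundedUnder_flip ha

lemma upperEnvelope_le (h : ∀ x, |u x| ≤ M) (hv : UpperSemicontinuous v) (huv : ∀ x, u x ≤ v x)
    (x : E n) : upperEnvelope u x ≤ v x := by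
  refine le_of_forall_gt_imp_ge_of_dense fun a ha => ?_
  refine upperEnvelope_le_of_eventually_le h ?_
  filter_upwards [hv x a ha] with y hy
  exact (huv y).trans hy.le

lemma abs_upperEnvelope_le (h : ∀ x, |u x| ≤ M) (x : E n) : |upperEnvelope u x| ≤ M :=
  abs_le.2 ⟨(abs_le.1 (h x)).1.trans (le_upperEnvelope h x),
    upperEnvelope_le_of_eventually_le h (Eventually.of_forall fun y => (abs_le.1 (h y)).2)⟩

lemma upperSemicontinuous_upperEnvelope (h : ∀ x, |u x| ≤ M) :
    UpperSemicontinuous (upperEnvelope u) := by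
  intro x a ha
  obtain ⟨a', h1, h2⟩ := exists_between ha
  have h3 : ∀ᶠ y in 𝓝 x, u y < a' :=
    eventually_lt_of_limsup_lt h1 (isBoundedUnder_le_of_abs_le h _)
  filter_upwards [h3.eventually_nhds] with y hy
  exact (upperEnvelope_le_of_eventually_le h (hy.mono fun _ => le_of_lt)).trans_lt h2

lemma frequently_lt_of_lt_upperEnvelope (h : ∀ x, |u x| ≤ M) {x : E n} {a : ℝ}
    (ha : a < upperEnvelope u x) : ∃ᶠ y in 𝓝 x, a < u y :=
  frequently_lt_of_lt_limsup (isBoundedUnder_ge_of_abs_le h _).isCoboundedUnder_flip ha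

lemma upperEnvelope_eq_of_upperSemicontinuous (h : ∀ x, |u x| ≤ M) (hu : UpperSemicontinuous u) :
    upperEnvelope u = u :=
  funext fun x => le_antisymm (upperEnvelope_le h hu (fun _ => le_rfl) x) (le_upperEnvelope h x)

lemma lowerEnvelope_eq_neg (h : ∀ x, |u x| ≤ M) (x : E n) :
    lowerEnvelope u x = -upperEnvelope (fun y => -u y) x := by
  have := Antitone.map_liminf_of_continuousAt (F := 𝓝 x) (f := fun t : ℝ => -t)
    (fun a b hab => neg_le_neg hab) u continuous_neg.continuousAt
    (isBoundedUnder_le_of_abs_le h _).isCoboundedUnder_flip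
    (isBoundedUnder_ge_of_abs_le h _)
  rw [upperEnvelope, lowerEnvelope]
  change -_ = limsup (fun y => -u y) (𝓝 x) at this
  rw [← this, neg_neg]

lemma lowerEnvelope_le (h : ∀ x, |u x| ≤ M) (x : E n) : lowerEnvelope u x ≤ u x := by
  rw [lowerEnvelope_eq_neg h]
  have := le_upperEnvelope (u := fun y => -u y) (M := M) (by simpa using h) x
  linarith

lemma abs_lowerEnvelope_le (h : ∀ x, |u x| ≤ M) (x : E n) : |lowerEnvelope u x| ≤ M := by
  rw [lowerEnvelope_eq_neg h, abs_neg]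
  exact abs_upperEnvelope_le (by simpa using h) x

lemma lowerSemicontinuous_lowerEnvelope (h : ∀ x, |u x| ≤ M) :
    LowerSemicontinuous (lowerEnvelope u) := by
  intro x a ha
  rw [lowerEnvelope_eq_neg h] at ha
  filter_upwards [upperSemicontinuous_upperEnvelope (u := fun y => -u y) (M := M)
    (by simpa using h) x (-a) (by linarith)] with y hy
  rw [lowerEnvelope_eq_neg h]
  linarith

lemma le_lowerEnvelope (h : ∀ x, |u x| ≤ M) (hv : LowerSemicontinuous v) (huv : ∀ x, v x ≤ u x)
    (x : E n) : v x ≤ lowerEnvelope u x := by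
  rw [lowerEnvelope_eq_neg h]
  have := upperEnvelope_le (u := fun y => -u y) (v := fun y => -v y) (M := M) (by simpa using h)
    (fun x a ha => by
      filter_upwards [hv x (-a) (by linarith)] with y hy
      linarith) (fun x => neg_le_neg (huv x)) x
  linarith

end Envelopes

/-! ### Elliptic operators -/

/-- The properties of a nonlocal operator that Perron's method uses: degenerate ellipticity,
continuity in the point and in the value, and continuity along lines of test functions. -/
structure IsEllipticOn {n : ℕ} (I : E n → ℝ → (E n → ℝ) → ℝ) (Ω : Set (E n)) : Prop where
  ellipticity : ∀ φ ψ : E n → ℝ, ContDiff ℝ 2 φ → BoundedFun φ → ContDiff ℝ 2 ψ → BoundedFun ψ →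
    ∀ x ∈ Ω, ∀ r, (∀ y, φ y - φ x ≤ ψ y - ψ x) → I x r ψ ≤ I x r φ
  continuity : ∀ φ : E n → ℝ, ContDiff ℝ 2 φ → BoundedFun φ → ∀ x ∈ Ω, ∀ r,
    ContinuousWithinAt (fun p : E n × ℝ => I p.1 p.2 φ) (Ω ×ˢ univ) (x, r)
  perturbation : ∀ φ η : E n → ℝ, ContDiff ℝ 2 φ → BoundedFun φ → ContDiff ℝ 2 η → BoundedFun η →
    ∃ C, ∀ x ∈ Ω, ∀ r t, |I x r (fun y => φ y + t * η y) - I x r φ| ≤ C * |t|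

lemma BoundedFun.add {n : ℕ} {u v : E n → ℝ} (hu : BoundedFun u) (hv : BoundedFun v) :
    BoundedFun fun x => u x + v x := by
  obtain ⟨M, hM⟩ := hu
  obtain ⟨N, hN⟩ := hv
  exact ⟨M + N, fun x => (abs_add_le _ _).trans (add_le_add (hM x) (hN x))⟩

lemma BoundedFun.const_mul {n : ℕ} {u : E n → ℝ} (hu : BoundedFun u) (t : ℝ) :
    BoundedFun fun x => t * u x := by
  obtain ⟨M, hM⟩ := hu
  exact ⟨|t| * M, fun x => by
    rw [abs_mul]; exact mul_le_mul_of_nonneg_left (hM x) (abs_nonneg _)⟩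

lemma BoundedFun.neg {n : ℕ} {u : E n → ℝ} (hu : BoundedFun u) : BoundedFun fun x => -u x := by
  obtain ⟨M, hM⟩ := hu
  exact ⟨M, by simpa using hM⟩

/-- The operator of the equation satisfied by `-u`. -/
def dualOp {n : ℕ} (I : E n → ℝ → (E n → ℝ) → ℝ) (x : E n) (r : ℝ) (φ : E n → ℝ) : ℝ :=
  -I x (-r) (fun y => -φ y)

lemma IsEllipticOn.dualOp {n : ℕ} {I : E n → ℝ → (E n → ℝ) → ℝ} {Ω : Set (E n)}
    (hI : IsEllipticOn I Ω) : IsEllipticOn (dualOp I) Ω where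
  ellipticity φ ψ h1 h2 h3 h4 x hx r h :=
    neg_le_neg (hI.ellipticity _ _ h3.neg h4.neg h1.neg h2.neg x hx (-r) fun y => by
      have := h y; linarith)
  continuity φ h1 h2 x hx r := by
    have h := hI.continuity _ h1.neg h2.neg x hx (-r)
    have h' : ContinuousWithinAt (fun p : E n × ℝ => (p.1, -p.2)) (Ω ×ˢ univ) (x, r) :=
      (by fun_prop : Continuous fun p : E n × ℝ => (p.1, -p.2)).continuousWithinAt
    exact (ContinuousWithinAt.comp (t := Ω ×ˢ univ) (f := fun p : E n × ℝ => (p.1, -p.2)) h h'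
      fun p hp => ⟨hp.1, trivial⟩).neg
  perturbation φ η h1 h2 h3 h4 := by
    obtain ⟨C, hC⟩ := hI.perturbation _ _ h1.neg h2.neg h3.neg h4.neg
    refine ⟨C, fun x hx r t => ?_⟩
    have := hC x hx (-r) t
    rw [abs_sub_comm] at this
    have e : (fun y => -(φ y + t * η y)) = fun y => -φ y + t * -η y := by ext y; ring
    simp only [NonlocalIsaacs.dualOp, e]
    rwa [neg_sub_neg]

lemma isViscositySupersolution_iff_neg {n : ℕ} {I : E n → ℝ → (E n → ℝ) → ℝ} {Ω : Set (E n)}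
    {u : E n → ℝ} : IsViscositySupersolution I Ω u ↔
      IsViscositySubsolution (dualOp I) Ω (fun x => -u x) := by
  constructor
  · rintro ⟨h1, h2, h3⟩
    refine ⟨h1.neg, fun x a ha => ?_, fun φ hφ hb x hx hm => ?_⟩
    · filter_upwards [h2 x (-a) (by linarith)] with y hy
      linarith
    · have := h3 _ hφ.neg hb.neg x hx fun y => by have := hm y; linarith
      simpa [dualOp] using this
  · rintro ⟨h1, h2, h3⟩
    refine ⟨by simpa using h1.neg, fun x a ha => ?_, fun φ hφ hb x hx hm => ?_⟩
    · filter_upwards [h2 x (-a) (by linarith)] with y hy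
      linarith
    · have := h3 _ hφ.neg hb.neg x hx fun y => by have := hm y; linarith
      simpa [dualOp] using this

/-! ### A bounded smooth penalisation -/

/-- A bounded smooth function with a strict minimum at `x`. -/
noncomputable def penalty {n : ℕ} (x y : E n) : ℝ := ‖y - x‖ ^ 2 / (1 + ‖y - x‖ ^ 2)

lemma contDiff_penalty {n : ℕ} (x : E n) : ContDiff ℝ 2 (penalty x) := by
  have h : ContDiff ℝ 2 fun y : E n => ‖y - x‖ ^ 2 := (contDiff_id.sub contDiff_const).norm_sq ℝ
  exact h.div (contDiff_const.add h) fun y => by positivity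

lemma penalty_nonneg {n : ℕ} (x y : E n) : 0 ≤ penalty x y := by unfold penalty; positivity

lemma penalty_le_one {n : ℕ} (x y : E n) : penalty x y ≤ 1 := by
  unfold penalty
  rw [div_le_one (by positivity)]
  linarith

lemma boundedFun_penalty {n : ℕ} (x : E n) : BoundedFun (penalty x) :=
  ⟨1, fun y => by rw [abs_of_nonneg (penalty_nonneg x y)]; exact penalty_le_one x y⟩

@[simp] lemma penalty_self {n : ℕ} (x : E n) : penalty x x = 0 := by simp [penalty]

lemma le_penalty {n : ℕ} {x y : E n} {δ : ℝ} (hδ : 0 ≤ δ) (h : δ ≤ ‖y - x‖) :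
    δ ^ 2 / (1 + δ ^ 2) ≤ penalty x y := by
  unfold penalty
  rw [div_le_div_iff₀ (by positivity) (by positivity)]
  have : δ ^ 2 ≤ ‖y - x‖ ^ 2 := pow_le_pow_left₀ hδ h 2
  nlinarith

/-! ### Perron's method -/

/-- The upper envelope of a supremum of subsolutions is a subsolution. -/
theorem isViscositySubsolution_upperEnvelope_iSup {n : ℕ} {I : E n → ℝ → (E n → ℝ) → ℝ}
    {Ω : Set (E n)} (hΩ : IsOpen Ω) (hI : IsEllipticOn I Ω) {F : Set (E n → ℝ)}
    (hF : F.Nonempty) {M : ℝ} (hM : ∀ w ∈ F, ∀ x, |w x| ≤ M)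
    (hsub : ∀ w ∈ F, IsViscositySubsolution I Ω w) :
    IsViscositySubsolution I Ω (upperEnvelope fun x => ⨆ w : F, w.1 x) := by
  set V : E n → ℝ := fun x => ⨆ w : F, w.1 x with hV
  have : Nonempty F := hF.to_subtype
  have hbdd : ∀ x, BddAbove (range fun w : F => w.1 x) := fun x =>
    ⟨M, by rintro _ ⟨w, rfl⟩; exact (abs_le.1 (hM w.1 w.2 x)).2⟩
  have hVle : ∀ w ∈ F, ∀ x, w x ≤ V x := fun w hw x => le_ciSup (hbdd x) ⟨w, hw⟩
  have hVM : ∀ x, |V x| ≤ M := by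
    intro x
    obtain ⟨w, hw⟩ := hF
    exact abs_le.2 ⟨(abs_le.1 (hM w hw x)).1.trans (hVle w hw x),
      ciSup_le fun w => (abs_le.1 (hM w.1 w.2 x)).2⟩
  set U := upperEnvelope V with hU
  have hVU : ∀ x, V x ≤ U x := le_upperEnvelope hVM
  refine ⟨⟨M, abs_upperEnvelope_le hVM⟩, upperSemicontinuous_upperEnvelope hVM, ?_⟩
  intro φ hφ hφb x hx hmax
  have key : ∀ ε > 0, I x (U x) (fun y => φ y + ε * penalty x y) ≤ 0 := by
    intro ε hε
    by_contra! hpos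
    have hcd : ContDiff ℝ 2 fun y => φ y + ε * penalty x y :=
      hφ.add (contDiff_const.mul (contDiff_penalty x))
    have hbd : BoundedFun fun y => φ y + ε * penalty x y :=
      hφb.add ((boundedFun_penalty x).const_mul ε)
    have hev := (hI.continuity _ hcd hbd x hx (U x)).eventually (eventually_gt_nhds hpos)
    have hΩn : Ω ×ˢ (univ : Set ℝ) ∈ 𝓝 (x, U x) := prod_mem_nhds (hΩ.mem_nhds hx) univ_mem
    rw [nhdsWithin_eq_nhds.2 hΩn] at hev
    obtain ⟨δ, hδ, hball⟩ := Metric.mem_nhds_iff.1 (inter_mem hev hΩn)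
    obtain ⟨δ₁, hδ₁, hφδ⟩ := Metric.continuous_iff.1 hφ.continuous x (δ / 4) (by positivity)
    set d := min (δ / 2) (δ₁ / 2) with hd
    have hd0 : 0 < d := by positivity
    set m := d ^ 2 / (1 + d ^ 2) with hm
    have hm0 : 0 < m := by positivity
    set τ := min (ε * m / 2) (δ / 4) with hτ
    have hτ0 : 0 < τ := by positivity
    -- a nearby point where one of the subsolutions almost attains the envelope
    have hfreq : ∃ᶠ y in 𝓝 x, U x - τ / 3 < V y :=
      frequently_lt_of_lt_upperEnvelope hVM (by linarith)
    have e1 : ∀ᶠ y in 𝓝 x, φ y < φ x + τ / 3 :=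
      hφ.continuous.continuousAt.eventually (eventually_lt_nhds (by linarith))
    have e2 : ∀ᶠ y in 𝓝 x, ε * penalty x y < τ / 3 := by
      have : ContinuousAt (fun y => ε * penalty x y) x :=
        (continuous_const.mul (contDiff_penalty x).continuous).continuousAt
      exact this.eventually (eventually_lt_nhds (by simpa using by positivity))
    have e3 : ∀ᶠ y in 𝓝 x, y ∈ ball x d := ball_mem_nhds x hd0
    obtain ⟨x', hx'V, hx'φ, hx'q, hx'd⟩ := (hfreq.and_eventually (e1.and (e2.and e3))).exists
    obtain ⟨⟨w, hwF⟩, hw⟩ := exists_lt_of_lt_ciSup hx'V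
    change U x - τ / 3 < w x' at hw
    have hwsub := hsub w hwF
    have hwU : ∀ y, w y ≤ U y := fun y => (hVle w hwF y).trans (hVU y)
    have husc : UpperSemicontinuous fun y => w y + -(φ y + ε * penalty x y) :=
      hwsub.2.1.add hcd.continuous.neg.upperSemicontinuous
    obtain ⟨y, hyd, hy⟩ := UpperSemicontinuousOn.exists_isMaxOn
      (s := closedBall x d) ⟨x, mem_closedBall_self hd0.le⟩ (isCompact_closedBall x d)
      (husc.upperSemicontinuousOn _)
    have hy' := hy (ball_subset_closedBall hx'd)
    simp only [mem_ofPred_eq] at hy'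
    have hglob : ∀ z, w z - (φ z + ε * penalty x z) ≤ w y - (φ y + ε * penalty x y) := by
      intro z
      by_cases hz : z ∈ closedBall x d
      · have := hy hz
        simp only [mem_ofPred_eq] at this
        linarith
      · rw [mem_closedBall, not_le, dist_eq_norm] at hz
        have h1 : m ≤ penalty x z := le_penalty hd0.le hz.le
        have h2 := hmax z
        have h3 := hwU z
        have h4 : ε * m ≤ ε * penalty x z := mul_le_mul_of_nonneg_left h1 hε.le
        have h5 : τ ≤ ε * m / 2 := min_le_left _ _
        nlinarith
    have hyφ : |φ y - φ x| < δ / 4 := hφδ y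
      ((mem_closedBall.1 hyd).trans_lt ((min_le_right _ _).trans_lt (by linarith)))
    have hq := mul_nonneg hε.le (penalty_nonneg x y)
    have hτδ : τ ≤ δ / 4 := min_le_right _ _
    have hlow : U x - δ < w y := by
      have := (abs_lt.1 hyφ).1
      linarith
    have hupp : w y < U x + δ := by
      have h1 := hmax y
      have h2 := hwU y
      have := (abs_lt.1 hyφ).2
      linarith
    have hmem : ((y, w y) : E n × ℝ) ∈ ball (x, U x) δ := by
      rw [mem_ball, Prod.dist_eq, max_lt_iff]
      refine ⟨(mem_closedBall.1 hyd).trans_lt ((min_le_left _ _).trans_lt (by linarith)), ?_⟩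
      rw [Real.dist_eq, abs_lt]
      constructor <;> linarith
    have h := hball hmem
    exact absurd (hwsub.2.2 _ hcd hbd y h.2.1 hglob) (not_le.2 h.1)
  obtain ⟨C, hC⟩ := hI.perturbation φ (penalty x) hφ hφb (contDiff_penalty x) (boundedFun_penalty x)
  refine le_of_forall_pos_le_add fun ε hε => ?_
  have hC' : 0 < |C| + 1 := by positivity
  have h1 := key (ε / (|C| + 1)) (by positivity)
  have h2 := (abs_le.1 (hC x hx (U x) (ε / (|C| + 1)))).1
  rw [abs_of_pos (by positivity : 0 < ε / (|C| + 1))] at h2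
  have h3 : C * (ε / (|C| + 1)) ≤ ε := by
    rw [mul_div_assoc', div_le_iff₀ hC']
    nlinarith [le_abs_self C]
  linarith

/-- The maximum of a subsolution and a strict smooth subsolution that only matters near a point. -/
theorem isViscositySubsolution_max {n : ℕ} {I : E n → ℝ → (E n → ℝ) → ℝ}
    {Ω : Set (E n)} (hI : IsEllipticOn I Ω) {u ψ : E n → ℝ} (hu : IsViscositySubsolution I Ω u)
    (hψ : ContDiff ℝ 2 ψ) (hψb : BoundedFun ψ)
    (h : ∀ x ∈ Ω, u x < ψ x → I x (ψ x) ψ ≤ 0) :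
    IsViscositySubsolution I Ω fun x => max (u x) (ψ x) := by
  obtain ⟨⟨M, hM⟩, husc, hsub⟩ := hu
  obtain ⟨N, hN⟩ := id hψb
  refine ⟨⟨max M N, fun x => ?_⟩, husc.sup hψ.continuous.upperSemicontinuous, ?_⟩
  · rcases max_choice (u x) (ψ x) with e | e <;> simp only [e]
    · exact (hM x).trans (le_max_left _ _)
    · exact (hN x).trans (le_max_right _ _)
  · intro φ hφ hφb x hx hmax
    rcases le_or_gt (ψ x) (u x) with hle | hlt
    · simp only [max_eq_left hle] at hmax ⊢
      exact hsub φ hφ hφb x hx fun y => (sub_le_sub_right (le_max_left _ _) _).trans (hmax y)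
    · simp only [max_eq_right hlt.le] at hmax ⊢
      refine (hI.ellipticity ψ φ hψ hψb hφ hφb x hx _ fun y => ?_).trans (h x hx hlt)
      have h1 := hmax y
      have h2 := le_max_right (u y) (ψ y)
      linarith

/-- Perron's method: a pair of ordered families of continuous barriers that determine the
exterior datum gives a discontinuous viscosity solution. -/
theorem exists_discontinuousViscositySolution {n : ℕ} {I : E n → ℝ → (E n → ℝ) → ℝ}
    {Ω : Set (E n)} (hΩ : IsOpen Ω) (hI : IsEllipticOn I Ω) {g : E n → ℝ}
    {Φ Ψ : Set (E n → ℝ)} (hΦ : Φ.Nonempty) (hΨ : Ψ.Nonempty) {M : ℝ}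
    (hΦM : ∀ φ ∈ Φ, ∀ x, |φ x| ≤ M) (hΨM : ∀ ψ ∈ Ψ, ∀ x, |ψ x| ≤ M)
    (hΦc : ∀ φ ∈ Φ, Continuous φ) (hΨc : ∀ ψ ∈ Ψ, Continuous ψ)
    (hΦsub : ∀ φ ∈ Φ, IsViscositySubsolution I Ω φ)
    (hΨsup : ∀ ψ ∈ Ψ, IsViscositySupersolution I Ω ψ)
    (hΦΨ : ∀ φ ∈ Φ, ∀ ψ ∈ Ψ, ∀ x, φ x ≤ ψ x)
    (hΦg : ∀ x ∈ Ωᶜ, ∀ ε > 0, ∃ φ ∈ Φ, g x - ε ≤ φ x)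
    (hΨg : ∀ x ∈ Ωᶜ, ∀ ε > 0, ∃ ψ ∈ Ψ, ψ x ≤ g x + ε) :
    ∃ u : E n → ℝ, IsDiscontinuousViscositySolution I Ω g u := by
  set F : Set (E n → ℝ) :=
    {w | IsViscositySubsolution I Ω w ∧ (∀ x, |w x| ≤ M) ∧ ∀ ψ ∈ Ψ, ∀ x, w x ≤ ψ x} with hFdef
  have hΦF : Φ ⊆ F := fun φ hφ => ⟨hΦsub φ hφ, hΦM φ hφ, fun ψ hψ => hΦΨ φ hφ ψ hψ⟩
  have hF : F.Nonempty := hΦ.mono hΦF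
  have : Nonempty F := hF.to_subtype
  set V : E n → ℝ := fun x => ⨆ w : F, w.1 x with hV
  have hVle : ∀ w ∈ F, ∀ x, w x ≤ V x := fun w hw x =>
    le_ciSup (f := fun w : F => w.1 x)
      ⟨M, by rintro _ ⟨w, rfl⟩; exact (abs_le.1 (w.2.2.1 x)).2⟩ ⟨w, hw⟩
  have hVM : ∀ x, |V x| ≤ M := by
    intro x
    obtain ⟨w, hw⟩ := hF
    exact abs_le.2 ⟨(abs_le.1 (hw.2.1 x)).1.trans (hVle w hw x),
      ciSup_le fun w => (abs_le.1 (w.2.2.1 x)).2⟩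
  set u := upperEnvelope V with hu
  have huF : u ∈ F := ⟨isViscositySubsolution_upperEnvelope_iSup hΩ hI hF (fun w hw => hw.2.1)
    fun w hw => hw.1, abs_upperEnvelope_le hVM, fun ψ hψ =>
      upperEnvelope_le hVM (hΨc ψ hψ).upperSemicontinuous fun x => ciSup_le fun w => w.2.2.2 ψ hψ x⟩
  have hle : ∀ w ∈ F, ∀ x, w x ≤ u x := fun w hw x => (hVle w hw x).trans (le_upperEnvelope hVM x)
  have huM := huF.2.1
  have husc := huF.1.2.1
  have henv : upperEnvelope u = u := upperEnvelope_eq_of_upperSemicontinuous huM husc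
  -- the infimum of the upper barriers
  set W : E n → ℝ := fun x => ⨅ ψ : Ψ, ψ.1 x with hW
  have : Nonempty Ψ := hΨ.to_subtype
  have hWbdd : ∀ x, BddBelow (range fun ψ : Ψ => ψ.1 x) := fun x =>
    ⟨-M, by rintro _ ⟨ψ, rfl⟩; exact (abs_le.1 (hΨM ψ.1 ψ.2 x)).1⟩
  have hWle : ∀ ψ ∈ Ψ, ∀ x, W x ≤ ψ x := fun ψ hψ x => ciInf_le (hWbdd x) ⟨ψ, hψ⟩
  have hWM : ∀ x, |W x| ≤ M := by
    intro x
    obtain ⟨ψ, hψ⟩ := hΨ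
    exact abs_le.2 ⟨le_ciInf fun ψ => (abs_le.1 (hΨM ψ.1 ψ.2 x)).1,
      (hWle ψ hψ x).trans (abs_le.1 (hΨM ψ hψ x)).2⟩
  have huW : ∀ x, u x ≤ W x := fun x => le_ciInf fun ψ => huF.2.2 ψ.1 ψ.2 x
  have hWsup : IsViscositySupersolution I Ω (lowerEnvelope W) := by
    rw [isViscositySupersolution_iff_neg]
    have := isViscositySubsolution_upperEnvelope_iSup (F := (fun ψ x => -ψ x) '' Ψ) (M := M) hΩ
      hI.dualOp (hΨ.image _) (by rintro _ ⟨ψ, hψ, rfl⟩ x; simpa using hΨM ψ hψ x)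
      (by rintro _ ⟨ψ, hψ, rfl⟩; exact isViscositySupersolution_iff_neg.1 (hΨsup ψ hψ))
    convert this using 1
    ext x
    rw [lowerEnvelope_eq_neg hWM, neg_neg]
    congr 1
    ext z
    have : (⨆ w : ((fun ψ x => -ψ x) '' Ψ : Set (E n → ℝ)), w.1 z) = ⨆ ψ : Ψ, -ψ.1 z := by
      simp only [iSup]
      congr 1
      ext t
      simp
    rw [this]
    simp only [hW, iSup, iInf, Real.sInf_def, neg_neg]
    congr 1
    ext t
    simp [neg_eq_iff_eq_neg]
  have hlow_le : ∀ x, lowerEnvelope u x ≤ lowerEnvelope W x := fun x =>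
    le_lowerEnvelope hWM (lowerSemicontinuous_lowerEnvelope huM)
      (fun y => (lowerEnvelope_le huM y).trans (huW y)) x
  refine ⟨u, ⟨M, huM⟩, ⟨by rw [henv]; exact huF.1, fun x hx => ?_⟩,
    ⟨⟨⟨M, abs_lowerEnvelope_le huM⟩, lowerSemicontinuous_lowerEnvelope huM, ?_⟩, fun x hx => ?_⟩⟩
  · rw [henv]
    refine le_of_forall_pos_le_add fun ε hε => ?_
    obtain ⟨ψ, hψ, h⟩ := hΨg x hx ε hε
    exact (huF.2.2 ψ hψ x).trans h
  · intro φ hφ hφb x hx hmin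
    rcases (hlow_le x).eq_or_lt with heq | hlt
    · rw [heq] at hmin ⊢
      exact hWsup.2.2 φ hφ hφb x hx fun y => (hmin y).trans (sub_le_sub_right (hlow_le y) _)
    by_contra! hneg
    -- normalise the test function to touch at `x`
    set φ₀ : E n → ℝ := fun y => φ y + (lowerEnvelope u x - φ x) with hφ₀
    have hφ₀c : ContDiff ℝ 2 φ₀ := hφ.add contDiff_const
    have hφ₀b : BoundedFun φ₀ := hφb.add ⟨|lowerEnvelope u x - φ x|, fun _ => le_rfl⟩
    have hφ₀x : φ₀ x = lowerEnvelope u x := by simp [hφ₀]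
    have hφ₀u : ∀ y, φ₀ y ≤ u y := fun y => by
      have h1 := hmin y
      have h2 := lowerEnvelope_le huM y
      simp only [hφ₀]
      linarith
    have hneg₀ : I x (φ₀ x) φ₀ < 0 := by
      refine (hI.ellipticity φ φ₀ hφ hφb hφ₀c hφ₀b x hx _ fun y => ?_).trans_lt
        (by rw [hφ₀x]; exact hneg)
      simp only [hφ₀]
      linarith
    set a := I x (φ₀ x) φ₀ with ha
    have hev := (hI.continuity _ hφ₀c hφ₀b x hx (φ₀ x)).eventually
      (eventually_lt_nhds (by linarith : I x (φ₀ x) φ₀ < a / 2))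
    have hΩn : Ω ×ˢ (univ : Set ℝ) ∈ 𝓝 (x, φ₀ x) := prod_mem_nhds (hΩ.mem_nhds hx) univ_mem
    rw [nhdsWithin_eq_nhds.2 hΩn] at hev
    obtain ⟨δ₁, hδ₁, hball⟩ := Metric.mem_nhds_iff.1 (inter_mem hev hΩn)
    set e := (lowerEnvelope W x - lowerEnvelope u x) / 3 with he
    have he0 : 0 < e := by rw [he]; linarith
    have ev1 : ∀ᶠ y in 𝓝 x, lowerEnvelope W x - e < lowerEnvelope W y :=
      lowerSemicontinuous_lowerEnvelope hWM x _ (by linarith)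
    have ev2 : ∀ᶠ y in 𝓝 x, |φ₀ y - φ₀ x| < min e (δ₁ / 2) :=
      hφ₀c.continuous.continuousAt.eventually (Metric.ball_mem_nhds (φ₀ x) (by positivity))
    obtain ⟨δ₂, hδ₂, hball₂⟩ := Metric.mem_nhds_iff.1 (ev1.and ev2)
    set δ := min δ₁ δ₂ with hδ
    have hδ0 : 0 < δ := by positivity
    let η : ContDiffBump x := ⟨δ / 2, δ, by positivity, by linarith⟩
    have hηc : ContDiff ℝ 2 η := η.contDiff
    have hηb : BoundedFun η := ⟨1, fun y => by rw [abs_of_nonneg η.nonneg]; exact η.le_one⟩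
    have hηsupp : ∀ y, y ∉ ball x δ → η y = 0 := fun y hy =>
      η.zero_of_le_dist (not_lt.1 hy)
    obtain ⟨C, hC⟩ := hI.perturbation φ₀ η hφ₀c hφ₀b hηc hηb
    have hC' : 0 < |C| + 1 := by positivity
    set t := min (min e (δ₁ / 4)) (-a / 2 / (|C| + 1)) with ht
    have ht0 : 0 < t := by
      have : 0 < -a / 2 := by linarith
      positivity
    have hte : t ≤ e := (min_le_left _ _).trans (min_le_left _ _)
    have htδ : t ≤ δ₁ / 4 := (min_le_left _ _).trans (min_le_right _ _)
    have htC : C * t ≤ -a / 2 := by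
      have h1 : t * (|C| + 1) ≤ -a / 2 := by
        rw [← le_div_iff₀ hC']; exact min_le_right _ _
      nlinarith [le_abs_self C]
    set ζ : E n → ℝ := fun y => φ₀ y + t * η y with hζ
    have hζc : ContDiff ℝ 2 ζ := hφ₀c.add (contDiff_const.mul hηc)
    have hζb : BoundedFun ζ := hφ₀b.add (hηb.const_mul t)
    have hmaxsub : IsViscositySubsolution I Ω fun y => max (u y) (ζ y) := by
      refine isViscositySubsolution_max hI huF.1 hζc hζb fun y hy hlt' => ?_
      have hyδ : y ∈ ball x δ := by
        by_contra hn
        have := hηsupp y hn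
        simp only [hζ, this, mul_zero, add_zero] at hlt'
        exact absurd (hφ₀u y) (not_le.2 hlt')
      have hη0 : 0 ≤ t * η y := mul_nonneg ht0.le η.nonneg
      have hη1 : t * η y ≤ t := mul_le_of_le_one_right ht0.le η.le_one
      have h2 := (hball₂ (ball_subset_ball (min_le_right _ _) hyδ)).2
      have h2' := abs_lt.1 (h2.trans_le (min_le_right _ _))
      have hmem : ((y, ζ y) : E n × ℝ) ∈ ball (x, φ₀ x) δ₁ := by
        rw [mem_ball, Prod.dist_eq, max_lt_iff]
        refine ⟨(mem_ball.1 hyδ).trans_le (min_le_left _ _), ?_⟩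
        simp only [hζ]
        rw [Real.dist_eq, abs_lt]
        constructor <;> linarith [h2'.1, h2'.2]
      have h3 : I y (ζ y) φ₀ < a / 2 := (hball hmem).1
      have h4 := (abs_le.1 (hC y hy (ζ y) t)).2
      rw [abs_of_pos ht0] at h4
      change I y (ζ y) ζ - _ ≤ _ at h4
      linarith
    have hζW : ∀ y, max (u y) (ζ y) ≤ W y := by
      intro y
      refine max_le (huW y) ?_
      by_cases hyδ : y ∈ ball x δ
      · have hη1 : t * η y ≤ t := mul_le_of_le_one_right ht0.le η.le_one
        obtain ⟨h1, h2⟩ := hball₂ (ball_subset_ball (min_le_right _ _) hyδ)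
        have h2' := (abs_lt.1 (h2.trans_le (min_le_left _ _))).2
        have h3 := lowerEnvelope_le hWM y
        simp only [hζ]
        linarith
      · simp only [hζ, hηsupp y hyδ, mul_zero, add_zero]
        exact (hφ₀u y).trans (huW y)
    have hmaxF : (fun y => max (u y) (ζ y)) ∈ F :=
      ⟨hmaxsub, fun y => abs_le.2 ⟨(abs_le.1 (huM y)).1.trans (le_max_left _ _),
        (hζW y).trans (abs_le.1 (hWM y)).2⟩, fun ψ hψ y => (hζW y).trans (hWle ψ hψ y)⟩
    have hζu : ∀ y, ζ y ≤ u y := fun y => (le_max_right _ _).trans (hle _ hmaxF y)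
    have h1 := le_lowerEnvelope huM hζc.continuous.lowerSemicontinuous hζu x
    have h2 : ζ x = φ₀ x + t := by
      simp only [hζ]
      rw [η.one_of_mem_closedBall (mem_closedBall_self (by positivity)), mul_one]
    linarith
  · refine le_of_forall_pos_le_add fun ε hε => ?_
    obtain ⟨φ, hφ, h⟩ := hΦg x hx ε hε
    have := le_lowerEnvelope huM (hΦc φ hφ).lowerSemicontinuous (hle φ (hΦF hφ)) x
    linarith

end NonlocalIsaacs
namespace NonlocalIsaacs

/-! ### Moments of the kernels -/

lemma measurableSet_annulus (n : ℕ) (δ : ℝ) : MeasurableSet (annulus n δ) :=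
  measurableSet_ball.diff measurableSet_ball

lemma mem_annulus {n : ℕ} {δ : ℝ} {z : E n} : z ∈ annulus n δ ↔ δ ≤ ‖z‖ ∧ ‖z‖ < 2 * δ := by
  simp [annulus, and_comm]

namespace IsKernel

variable {n : ℕ} {σ Λ : ℝ} {k : E n → ℝ}

lemma measurable_rpow_mul (hk : IsKernel σ Λ k) (p : ℝ) :
    Measurable fun z => ‖z‖ ^ p * k z :=
  (measurable_norm.pow_const p).mul hk.measurable

lemma rpow_mul_nonneg (hk : IsKernel σ Λ k) (p : ℝ) (z : E n) : 0 ≤ ‖z‖ ^ p * k z :=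
  mul_nonneg (Real.rpow_nonneg (norm_nonneg z) p) (hk.nonneg z)

lemma lintegral_annulus_le (hk : IsKernel σ Λ k) {p δ : ℝ} (hp : 0 ≤ p) (hδ : 0 < δ) :
    ∫⁻ z in annulus n δ, ENNReal.ofReal (‖z‖ ^ p * k z) ≤
      ENNReal.ofReal (2 ^ p * ((2 - σ) * Λ) * δ ^ (p - σ)) := by
  calc ∫⁻ z in annulus n δ, ENNReal.ofReal (‖z‖ ^ p * k z)
      ≤ ∫⁻ z in annulus n δ, ENNReal.ofReal ((2 * δ) ^ p) * ENNReal.ofReal (k z) := by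
        refine setLIntegral_mono' (measurableSet_annulus n δ) fun z hz => ?_
        rw [← ENNReal.ofReal_mul (by positivity)]
        refine ENNReal.ofReal_le_ofReal (mul_le_mul_of_nonneg_right ?_ (hk.nonneg z))
        exact Real.rpow_le_rpow (norm_nonneg z) (mem_annulus.1 hz).2.le hp
    _ = ENNReal.ofReal ((2 * δ) ^ p) * ∫⁻ z in annulus n δ, ENNReal.ofReal (k z) :=
        lintegral_const_mul _ hk.measurable.ennreal_ofReal
    _ ≤ ENNReal.ofReal ((2 * δ) ^ p) * ENNReal.ofReal ((2 - σ) * Λ * δ ^ (-σ)) := by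
        gcongr
        exact hk.mass_le δ hδ
    _ = _ := by
        rw [← ENNReal.ofReal_mul (by positivity), Real.mul_rpow two_pos.le hδ.le, sub_eq_add_neg p σ,
          Real.rpow_add hδ]
        ring_nf

lemma lintegral_le_of_subset_iUnion (hk : IsKernel σ Λ k) (hσ2 : σ < 2) (hΛ : 0 < Λ)
    {p a q : ℝ} (hp : 0 ≤ p) (ha : 0 < a) (hq : 0 < q) (hq1 : q ^ (p - σ) < 1) {S : Set (E n)}
    (hS : S ⊆ ⋃ j : ℕ, annulus n (a * q ^ j)) :
    ∫⁻ z in S, ENNReal.ofReal (‖z‖ ^ p * k z) ≤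
      ENNReal.ofReal (2 ^ p * ((2 - σ) * Λ) * (1 - q ^ (p - σ))⁻¹ * a ^ (p - σ)) := by
  have h2 : 0 < 2 - σ := by linarith
  have hq0 : 0 ≤ q ^ (p - σ) := by positivity
  have hsum : HasSum (fun j : ℕ => 2 ^ p * ((2 - σ) * Λ) * (a * q ^ j) ^ (p - σ))
      (2 ^ p * ((2 - σ) * Λ) * (1 - q ^ (p - σ))⁻¹ * a ^ (p - σ)) := by
    have := (hasSum_geometric_of_lt_one hq0 hq1).mul_left
      (2 ^ p * ((2 - σ) * Λ) * a ^ (p - σ))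
    have e : ∀ j : ℕ, (a * q ^ j) ^ (p - σ) = a ^ (p - σ) * (q ^ (p - σ)) ^ j := fun j => by
      rw [Real.mul_rpow ha.le (by positivity), ← Real.rpow_natCast, ← Real.rpow_mul hq.le,
        mul_comm (j : ℝ), Real.rpow_mul hq.le, Real.rpow_natCast]
    simp only [e]
    simpa only [mul_assoc, mul_comm, mul_left_comm] using this
  calc ∫⁻ z in S, ENNReal.ofReal (‖z‖ ^ p * k z)
      ≤ ∫⁻ z in ⋃ j : ℕ, annulus n (a * q ^ j), ENNReal.ofReal (‖z‖ ^ p * k z) :=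
        lintegral_mono_set hS
    _ ≤ ∑' j : ℕ, ∫⁻ z in annulus n (a * q ^ j), ENNReal.ofReal (‖z‖ ^ p * k z) :=
        lintegral_iUnion_le _ _
    _ ≤ ∑' j : ℕ, ENNReal.ofReal (2 ^ p * ((2 - σ) * Λ) * (a * q ^ j) ^ (p - σ)) :=
        ENNReal.tsum_le_tsum fun j => hk.lintegral_annulus_le hp (by positivity)
    _ = _ := by
        rw [← ENNReal.ofReal_tsum_of_nonneg (fun j => by positivity) hsum.summable, hsum.tsum_eq]

lemma integrableOn_and_integral_le (hk : IsKernel σ Λ k) {p c : ℝ} (hc : 0 ≤ c) {S : Set (E n)}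
    (h : ∫⁻ z in S, ENNReal.ofReal (‖z‖ ^ p * k z) ≤ ENNReal.ofReal c) :
    IntegrableOn (fun z => ‖z‖ ^ p * k z) S ∧ ∫ z in S, ‖z‖ ^ p * k z ≤ c := by
  have hm := (hk.measurable_rpow_mul p).aestronglyMeasurable (μ := volume.restrict S)
  have hnn : 0 ≤ᵐ[volume.restrict S] fun z => ‖z‖ ^ p * k z :=
    Eventually.of_forall fun z => hk.rpow_mul_nonneg p z
  refine ⟨⟨hm, ?_⟩, ?_⟩
  · rw [hasFiniteIntegral_iff_ofReal hnn]
    exact h.trans_lt ENNReal.ofReal_lt_top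
  · rw [integral_eq_lintegral_of_nonneg_ae hnn hm]
    exact ENNReal.toReal_le_of_le_ofReal hc h

end IsKernel

lemma exists_zpow_annulus {n : ℕ} {s : ℝ} (hs : 0 < s) {z : E n} (hz : z ≠ 0) :
    ∃ m : ℤ, s * 2 ^ m ≤ ‖z‖ ∧ ‖z‖ < s * 2 ^ (m + 1) := by
  have hz' : 0 < ‖z‖ := norm_pos_iff.2 hz
  obtain ⟨m, h1, h2⟩ := exists_mem_Ico_zpow (div_pos hz' hs) (one_lt_two (α := ℝ))
  exact ⟨m, by rwa [le_div_iff₀ hs, mul_comm] at h1, by rwa [div_lt_iff₀ hs, mul_comm] at h2⟩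

lemma ball_diff_subset_iUnion_annulus {n : ℕ} {s : ℝ} (hs : 0 < s) :
    ball (0 : E n) s \ {0} ⊆ ⋃ j : ℕ, annulus n (s / 2 * (1 / 2) ^ j) := by
  rintro z ⟨hz, hz0⟩
  rw [mem_ball_zero_iff] at hz
  obtain ⟨m, h1, h2⟩ := exists_zpow_annulus hs hz0
  have hm : m < 0 := by
    by_contra! hm
    have : (1 : ℝ) ≤ 2 ^ m := one_le_zpow₀ one_le_two hm
    nlinarith
  obtain ⟨j, hj⟩ := Int.eq_ofNat_of_zero_le (show 0 ≤ -m - 1 by omega)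
  obtain rfl : m = -((j : ℤ) + 1) := by omega
  have e : (2 : ℝ) ^ (-((j : ℤ) + 1)) = 1 / 2 * (1 / 2) ^ j := by
    rw [zpow_neg, zpow_add₀ two_ne_zero, zpow_natCast, zpow_one, mul_inv]
    simp [mul_comm]
  rw [zpow_add₀ two_ne_zero, e, zpow_one] at h2
  rw [e] at h1
  exact mem_iUnion.2 ⟨j, mem_annulus.2 ⟨by linarith, by linarith⟩⟩

lemma compl_ball_subset_iUnion_annulus {n : ℕ} {s : ℝ} (hs : 0 < s) :
    (ball (0 : E n) s)ᶜ ⊆ ⋃ j : ℕ, annulus n (s * 2 ^ j) := by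
  intro z hz
  rw [mem_compl_iff, mem_ball_zero_iff, not_lt] at hz
  obtain ⟨m, h1, h2⟩ := exists_zpow_annulus hs (norm_pos_iff.1 (hs.trans_le hz))
  have hm : 0 ≤ m := by
    by_contra! hm
    have : (2 : ℝ) ^ (m + 1) ≤ 1 := zpow_le_one_of_nonpos₀ one_le_two (by omega)
    nlinarith
  obtain ⟨j, rfl⟩ := Int.eq_ofNat_of_zero_le hm
  rw [zpow_add₀ two_ne_zero, zpow_natCast, zpow_one] at h2
  rw [zpow_natCast] at h1
  exact mem_iUnion.2 ⟨j, mem_annulus.2 ⟨h1, by linarith⟩⟩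

/-- Moments of order `p > σ` near the origin. -/
lemma exists_inner_moment_le (n : ℕ) {σ Λ p : ℝ} (hσ0 : 0 < σ) (hσ2 : σ < 2) (hΛ : 0 < Λ)
    (hp : σ < p) : ∃ C, 0 ≤ C ∧ ∀ k : E n → ℝ, IsKernel σ Λ k → ∀ s : ℝ, 0 < s →
      IntegrableOn (fun z => ‖z‖ ^ p * k z) (ball 0 s) ∧
        ∫ z in ball 0 s, ‖z‖ ^ p * k z ≤ C * s ^ (p - σ) := by
  have h2 : 0 < 2 - σ := by linarith
  have hq1 : (1 / 2 : ℝ) ^ (p - σ) < 1 :=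
    Real.rpow_lt_one (by norm_num) (by norm_num) (by linarith)
  have h1q : 0 < 1 - (1 / 2 : ℝ) ^ (p - σ) := by linarith
  refine ⟨2 ^ p * ((2 - σ) * Λ) * (1 - (1 / 2) ^ (p - σ))⁻¹, by positivity, fun k hk s hs => ?_⟩
  refine hk.integrableOn_and_integral_le (by positivity) ?_
  calc ∫⁻ z in ball 0 s, ENNReal.ofReal (‖z‖ ^ p * k z)
      ≤ ∫⁻ z in (ball 0 s \ {0}) ∪ {0}, ENNReal.ofReal (‖z‖ ^ p * k z) :=
        lintegral_mono_set (by simp)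
    _ ≤ (∫⁻ z in ball 0 s \ {0}, ENNReal.ofReal (‖z‖ ^ p * k z)) +
        ∫⁻ z in ({0} : Set (E n)), ENNReal.ofReal (‖z‖ ^ p * k z) := lintegral_union_le _ _ _
    _ ≤ ENNReal.ofReal (2 ^ p * ((2 - σ) * Λ) * (1 - (1 / 2) ^ (p - σ))⁻¹ * (s / 2) ^ (p - σ))
        + 0 := by
        refine add_le_add (hk.lintegral_le_of_subset_iUnion hσ2 hΛ (by linarith) (by positivity)
          (by norm_num) hq1 (ball_diff_subset_iUnion_annulus hs)) (le_of_eq ?_)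
        rw [setLIntegral_congr_fun (g := fun _ => 0) (measurableSet_singleton _), lintegral_zero]
        rintro z rfl
        simp [Real.zero_rpow (by linarith : p ≠ 0)]
    _ ≤ _ := by
        rw [add_zero]
        refine ENNReal.ofReal_le_ofReal (mul_le_mul_of_nonneg_left ?_ (by positivity))
        exact Real.rpow_le_rpow (by positivity) (by linarith) (by linarith)

/-- Moments of order `0 ≤ p < σ` away from the origin. -/
lemma exists_outer_moment_le (n : ℕ) {σ Λ p : ℝ} (hσ2 : σ < 2) (hΛ : 0 < Λ)
    (hp0 : 0 ≤ p) (hp : p < σ) : ∃ C, 0 ≤ C ∧ ∀ k : E n → ℝ, IsKernel σ Λ k → ∀ s : ℝ, 0 < s →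
      IntegrableOn (fun z => ‖z‖ ^ p * k z) (ball 0 s)ᶜ ∧
        ∫ z in (ball 0 s)ᶜ, ‖z‖ ^ p * k z ≤ C * s ^ (p - σ) := by
  have h2 : 0 < 2 - σ := by linarith
  have hq1 : (2 : ℝ) ^ (p - σ) < 1 :=
    Real.rpow_lt_one_of_one_lt_of_neg (by norm_num) (by linarith)
  have h1q : 0 < 1 - (2 : ℝ) ^ (p - σ) := by linarith
  refine ⟨2 ^ p * ((2 - σ) * Λ) * (1 - 2 ^ (p - σ))⁻¹, by positivity, fun k hk s hs => ?_⟩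
  exact hk.integrableOn_and_integral_le (by positivity)
    (hk.lintegral_le_of_subset_iUnion hσ2 hΛ hp0 hs (by norm_num) hq1
      (compl_ball_subset_iUnion_annulus hs))

lemma norm_smul_le_rpow_one {n : ℕ} {σ Λ : ℝ} {k : E n → ℝ} (hk : IsKernel σ Λ k) (z : E n) :
    ‖k z • z‖ = ‖z‖ ^ (1 : ℝ) * k z := by
  rw [norm_smul, Real.norm_of_nonneg (hk.nonneg z), Real.rpow_one, mul_comm]

lemma IsKernel.integrableOn_smul {n : ℕ} {σ Λ : ℝ} {k : E n → ℝ} (hk : IsKernel σ Λ k)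
    {S : Set (E n)} (h : IntegrableOn (fun z => ‖z‖ ^ (1 : ℝ) * k z) S) :
    IntegrableOn (fun z => k z • z) S :=
  Integrable.mono h (hk.measurable.smul measurable_id).aestronglyMeasurable
    (Eventually.of_forall fun z => by
      rw [norm_smul_le_rpow_one hk, Real.norm_of_nonneg (hk.rpow_mul_nonneg 1 z)])

lemma IsKernel.integrableOn_smul_annulus {n : ℕ} {σ Λ : ℝ} (hσ2 : σ < 2) (hΛ : 0 < Λ)
    {k : E n → ℝ} (hk : IsKernel σ Λ k) {δ : ℝ} (hδ : 0 < δ) :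
    IntegrableOn (fun z => k z • z) (annulus n δ) := by
  have h2 : 0 < 2 - σ := by linarith
  exact hk.integrableOn_smul (hk.integrableOn_and_integral_le (by positivity)
    (hk.lintegral_annulus_le zero_le_one hδ)).1

/-- Kernels of order one have no first moment between dyadic radii. -/
lemma IsKernel.integral_dyadic_eq_zero {n : ℕ} {Λ : ℝ} (hΛ : 0 < Λ)
    {k : E n → ℝ} (hk : IsKernel 1 Λ k) (N : ℕ) :
    IntegrableOn (fun z => k z • z) (ball 0 1 \ ball 0 ((1 / 2) ^ N)) ∧
      ∫ z in ball 0 1 \ ball 0 ((1 / 2) ^ N), k z • z = 0 := by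
  induction N with
  | zero => simp
  | succ N ih =>
    have hd : (0 : ℝ) < (1 / 2) ^ (N + 1) := by positivity
    have e2 : 2 * (1 / 2 : ℝ) ^ (N + 1) = (1 / 2) ^ N := by rw [pow_succ]; ring
    have hle : (1 / 2 : ℝ) ^ N ≤ 1 := pow_le_one₀ (by norm_num) (by norm_num)
    have e : ball (0 : E n) 1 \ ball 0 ((1 / 2) ^ (N + 1)) =
        (ball 0 1 \ ball 0 ((1 / 2) ^ N)) ∪ annulus n ((1 / 2) ^ (N + 1)) := by
      ext z
      simp only [Set.mem_sdiff, mem_union, mem_ball_zero_iff, not_lt, mem_annulus, e2]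
      constructor
      · rintro ⟨h1, h2⟩
        rcases le_or_gt ((1 / 2 : ℝ) ^ N) ‖z‖ with h | h
        · exact Or.inl ⟨h1, h⟩
        · exact Or.inr ⟨h2, h⟩
      · rintro (⟨h1, h2⟩ | ⟨h1, h2⟩)
        · exact ⟨h1, by linarith⟩
        · exact ⟨by linarith, h1⟩
    have hdisj : Disjoint (ball (0 : E n) 1 \ ball 0 ((1 / 2) ^ N))
        (annulus n ((1 / 2) ^ (N + 1))) := by
      rw [Set.disjoint_left]
      intro z hz hz'
      simp only [Set.mem_sdiff, mem_ball_zero_iff, not_lt] at hz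
      have := (mem_annulus.1 hz').2
      linarith [hz.2]
    have hi := hk.integrableOn_smul_annulus (by norm_num) hΛ hd
    have hz : ∫ z in annulus n ((1 / 2) ^ (N + 1)), k z • z = 0 := by
      have := hk.moment_le _ hd
      simpa using this
    rw [e]
    refine ⟨ih.1.union hi, ?_⟩
    rw [setIntegral_union hdisj (measurableSet_annulus _ _) ih.1 hi, ih.2, hz, add_zero]

/-- The truncation of the gradient term in the compensated increment. -/
noncomputable def cutoff {n : ℕ} (σ : ℝ) (z : E n) : ℝ :=
  if σ < 1 then 0 else if σ = 1 then (ball (0 : E n) 1).indicator 1 z else 1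

lemma increment_eq {n : ℕ} (σ : ℝ) (φ : E n → ℝ) (x z : E n) :
    increment σ φ x z = φ (x + z) - φ x - cutoff σ z * fderiv ℝ φ x z := by
  unfold increment cutoff
  split_ifs with h1 h2
  · simp
  · by_cases hz : z ∈ ball (0 : E n) 1
    · rw [indicator_of_mem hz, indicator_of_mem hz]; simp
    · rw [indicator_of_notMem hz, indicator_of_notMem hz]; simp
  · simp

lemma measurable_cutoff {n : ℕ} (σ : ℝ) : Measurable (cutoff σ : E n → ℝ) := by
  unfold cutoff
  split_ifs
  · exact measurable_const
  · exact measurable_one.indicator measurableSet_ball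
  · exact measurable_const

/-- First moments of the truncated kernels outside dyadic balls. -/
lemma exists_cutoff_moment_le (n : ℕ) {σ Λ : ℝ} (hσ2 : σ < 2) (hΛ : 0 < Λ) :
    ∃ C, 0 ≤ C ∧ ∀ k : E n → ℝ, IsKernel σ Λ k → ∀ N : ℕ,
      IntegrableOn (fun z => (cutoff σ z * k z) • z) (ball 0 ((1 / 2) ^ N))ᶜ ∧
        ‖∫ z in (ball 0 ((1 / 2) ^ N))ᶜ, (cutoff σ z * k z) • z‖ ≤
          C * ((1 / 2 : ℝ) ^ N) ^ (1 - σ) := by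
  rcases lt_trichotomy σ 1 with h | rfl | h
  · exact ⟨0, le_rfl, fun k _ N => by simp [cutoff, h]⟩
  · refine ⟨0, le_rfl, fun k hk N => ?_⟩
    have e : ∀ z : E n, (cutoff 1 z * k z) • z = (ball (0 : E n) 1).indicator (fun z => k z • z) z := by
      intro z
      by_cases hz : z ∈ ball (0 : E n) 1
      · simp only [cutoff, lt_irrefl, if_false, if_true, indicator_of_mem hz]; simp
      · simp only [cutoff, lt_irrefl, if_false, if_true, indicator_of_notMem hz]; simp
    obtain ⟨h1, h2⟩ := hk.integral_dyadic_eq_zero hΛ N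
    have e' : (ball (0 : E n) ((1 / 2) ^ N))ᶜ ∩ ball 0 1 = ball 0 1 \ ball 0 ((1 / 2) ^ N) := by
      rw [inter_comm, sdiff_eq]
    simp only [e]
    constructor
    · rw [integrableOn_indicator_iff measurableSet_ball, inter_comm, e']
      exact h1
    · rw [setIntegral_indicator measurableSet_ball, e', h2]
      simp
  · obtain ⟨C, hC, hout⟩ := exists_outer_moment_le n hσ2 hΛ zero_le_one h
    refine ⟨C, hC, fun k hk N => ?_⟩
    obtain ⟨h1, h2⟩ := hout k hk ((1 / 2) ^ N) (by positivity)
    have e : ∀ z : E n, cutoff σ z * k z = k z := fun z => by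
      simp [cutoff, h.not_gt, h.ne']
    simp only [e]
    refine ⟨hk.integrableOn_smul h1, (norm_integral_le_integral_norm _).trans ?_⟩
    simpa only [norm_smul_le_rpow_one hk] using h2

end NonlocalIsaacs
namespace NonlocalIsaacs

/-! ### Increments of smooth functions -/

/-- The order of vanishing at the origin of compensated increments. -/
noncomputable def innerExp (σ : ℝ) : ℝ := if σ < 1 then 1 else 2

/-- The order of growth at infinity of compensated increments. -/
noncomputable def outerExp (σ : ℝ) : ℝ := if 1 < σ then 1 else 0

lemma lt_innerExp {σ : ℝ} (hσ2 : σ < 2) : σ < innerExp σ := by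
  unfold innerExp; split_ifs <;> linarith

lemma one_le_innerExp (σ : ℝ) : 1 ≤ innerExp σ := by unfold innerExp; split_ifs <;> norm_num

lemma outerExp_lt {σ : ℝ} (hσ0 : 0 < σ) : outerExp σ < σ := by
  unfold outerExp; split_ifs <;> linarith

lemma outerExp_nonneg (σ : ℝ) : 0 ≤ outerExp σ := by unfold outerExp; split_ifs <;> norm_num

/-- The size of compensated increments of bounded smooth functions. -/
noncomputable def growth {n : ℕ} (σ : ℝ) (z : E n) : ℝ :=
  if ‖z‖ < 1 then ‖z‖ ^ innerExp σ else ‖z‖ ^ outerExp σ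

lemma growth_nonneg {n : ℕ} (σ : ℝ) (z : E n) : 0 ≤ growth σ z := by
  unfold growth; split_ifs <;> positivity

lemma integrable_growth_mul {n : ℕ} {σ Λ : ℝ} (hσ0 : 0 < σ) (hσ2 : σ < 2) (hΛ : 0 < Λ) :
    ∃ C, 0 ≤ C ∧ ∀ k : E n → ℝ, IsKernel σ Λ k →
      Integrable (fun z => growth σ z * k z) ∧ ∫ z, growth σ z * k z ≤ C ∧
      (∀ s : ℝ, 0 < s → s ≤ 1 → ∫ z in ball 0 s, growth σ z * k z ≤ C * s ^ (innerExp σ - σ)) ∧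
      ∀ s : ℝ, 1 ≤ s → ∫ z in (ball 0 s)ᶜ, growth σ z * k z ≤ C * s ^ (outerExp σ - σ) := by
  obtain ⟨C₁, hC₁, h₁⟩ := exists_inner_moment_le n hσ0 hσ2 hΛ (lt_innerExp hσ2)
  obtain ⟨C₂, hC₂, h₂⟩ := exists_outer_moment_le n hσ2 hΛ (outerExp_nonneg σ) (outerExp_lt hσ0)
  have e1 : ∀ (k : E n → ℝ) (s : ℝ), s ≤ 1 →
      EqOn (fun z => ‖z‖ ^ innerExp σ * k z) (fun z => growth σ z * k z) (ball 0 s) := by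
    intro k s hs z hz
    simp [growth, (mem_ball_zero_iff.1 hz).trans_le hs]
  have e2 : ∀ (k : E n → ℝ) (s : ℝ), 1 ≤ s →
      EqOn (fun z => ‖z‖ ^ outerExp σ * k z) (fun z => growth σ z * k z) (ball 0 s)ᶜ := by
    intro k s hs z hz
    rw [mem_compl_iff, mem_ball_zero_iff, not_lt] at hz
    simp [growth, hs.trans hz]
  have b1 : ∀ k : E n → ℝ, IsKernel σ Λ k → ∀ s : ℝ, 0 < s → s ≤ 1 →
      ∫ z in ball 0 s, growth σ z * k z ≤ C₁ * s ^ (innerExp σ - σ) := by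
    intro k hk s hs hs1
    rw [← setIntegral_congr_fun measurableSet_ball (e1 k s hs1)]
    exact (h₁ k hk s hs).2
  have b2 : ∀ k : E n → ℝ, IsKernel σ Λ k → ∀ s : ℝ, 1 ≤ s →
      ∫ z in (ball 0 s)ᶜ, growth σ z * k z ≤ C₂ * s ^ (outerExp σ - σ) := by
    intro k hk s hs
    rw [← setIntegral_congr_fun measurableSet_ball.compl (e2 k s hs)]
    exact (h₂ k hk s (by linarith)).2
  refine ⟨C₁ + C₂, by positivity, fun k hk => ?_⟩
  have i1 : IntegrableOn (fun z => growth σ z * k z) (ball 0 1) :=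
    (h₁ k hk 1 one_pos).1.congr_fun (e1 k 1 le_rfl) measurableSet_ball
  have i2 : IntegrableOn (fun z => growth σ z * k z) (ball 0 1)ᶜ :=
    (h₂ k hk 1 one_pos).1.congr_fun (e2 k 1 le_rfl) measurableSet_ball.compl
  have i : Integrable (fun z => growth σ z * k z) := by
    rw [← integrableOn_univ, ← union_compl_self (ball (0 : E n) 1)]
    exact i1.union i2
  refine ⟨i, ?_, fun s hs hs1 => (b1 k hk s hs hs1).trans ?_, fun s hs => (b2 k hk s hs).trans ?_⟩
  · rw [← integral_add_compl measurableSet_ball i]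
    have := add_le_add (b1 k hk 1 one_pos le_rfl) (b2 k hk 1 le_rfl)
    simpa using this
  · gcongr; linarith
  · gcongr; linarith

/-- The tails of the kernels are uniformly small. -/
lemma exists_tail_le {n : ℕ} {σ Λ : ℝ} (hσ0 : 0 < σ) (hσ2 : σ < 2) (hΛ : 0 < Λ) {ε : ℝ}
    (hε : 0 < ε) : ∃ s R : ℝ, 0 < s ∧ s < R ∧ ∀ k : E n → ℝ, IsKernel σ Λ k →
      ∫ z in (ball 0 R \ ball 0 s)ᶜ, growth σ z * k z ≤ ε := by
  obtain ⟨C, hC, h⟩ := integrable_growth_mul (n := n) hσ0 hσ2 hΛ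
  have hi : 0 < innerExp σ - σ := by linarith [lt_innerExp hσ2]
  have ho : 0 < σ - outerExp σ := by linarith [outerExp_lt hσ0]
  have t1 : Tendsto (fun s : ℝ => C * s ^ (innerExp σ - σ)) (𝓝[>] 0) (𝓝 0) := by
    have := ((Real.continuousAt_rpow_const 0 (innerExp σ - σ) (Or.inr hi.le)).tendsto.const_mul
      C).mono_left (nhdsWithin_le_nhds (s := Ioi 0))
    simpa [Real.zero_rpow hi.ne'] using this
  have t2 : Tendsto (fun s : ℝ => C * s ^ (outerExp σ - σ)) atTop (𝓝 0) := by
    have := (tendsto_rpow_neg_atTop ho).const_mul C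
    simpa using this
  have m1 : ∀ᶠ s : ℝ in 𝓝[>] 0, 0 < s ∧ s < 1 := Ioo_mem_nhdsGT one_pos
  obtain ⟨s, hs, hs0, hs1⟩ :=
    ((t1.eventually (eventually_lt_nhds (half_pos hε))).and m1).exists
  obtain ⟨R, hR, hR1⟩ :=
    ((t2.eventually (eventually_lt_nhds (half_pos hε))).and (eventually_ge_atTop 1)).exists
  refine ⟨s, R, hs0, by linarith, fun k hk => ?_⟩
  obtain ⟨i, -, b1, b2⟩ := h k hk
  have e : (ball (0 : E n) R \ ball 0 s)ᶜ = ball 0 s ∪ (ball 0 R)ᶜ := by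
    rw [Set.sdiff_eq, compl_inter, compl_compl, union_comm]
  have hd : Disjoint (ball (0 : E n) s) (ball 0 R)ᶜ :=
    disjoint_compl_right_iff_subset.2 (ball_subset_ball (by linarith))
  rw [e, setIntegral_union hd measurableSet_ball.compl i.integrableOn i.integrableOn]
  linarith [b1 s hs0 hs1.le, b2 R hR1]

/-- First and second order expansions of a smooth function, uniformly on bounded sets. -/
lemma exists_taylor_bound {n : ℕ} {φ : E n → ℝ} (hφ : ContDiff ℝ 2 φ) {Ω : Set (E n)}
    (hΩ : Bornology.IsBounded Ω) : ∃ L, 0 ≤ L ∧ ∀ x ∈ Ω, ‖fderiv ℝ φ x‖ ≤ L ∧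
      ∀ z : E n, ‖z‖ < 1 → |φ (x + z) - φ x| ≤ L * ‖z‖ ∧
        |φ (x + z) - φ x - fderiv ℝ φ x z| ≤ L * ‖z‖ ^ 2 := by
  obtain ⟨R, hR⟩ := hΩ.subset_closedBall (0 : E n)
  have hφ1 : ContDiff ℝ 1 (fderiv ℝ φ) := hφ.fderiv_right (by norm_num)
  have hd : Differentiable ℝ φ := hφ.differentiable (by norm_num)
  have hd1 : Differentiable ℝ (fderiv ℝ φ) := hφ1.differentiable (by norm_num)
  have hc : IsCompact (closedBall (0 : E n) (R + 1)) := isCompact_closedBall _ _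
  obtain ⟨L₁, hL₁⟩ := hc.exists_bound_of_continuousOn hφ1.continuous.continuousOn
  obtain ⟨L₂, hL₂⟩ := hc.exists_bound_of_continuousOn
    (hφ1.continuous_fderiv (by norm_num)).continuousOn
  have hconv := convex_closedBall (0 : E n) (R + 1)
  refine ⟨max (max L₁ L₂) 0, le_max_right _ _, fun x hx => ?_⟩
  have hxR : ‖x‖ ≤ R := by simpa using hR hx
  have hxb : x ∈ closedBall (0 : E n) (R + 1) := by simp; linarith
  have l1 : L₁ ≤ max (max L₁ L₂) 0 := (le_max_left _ _).trans (le_max_left _ _)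
  have l2 : L₂ ≤ max (max L₁ L₂) 0 := (le_max_right _ _).trans (le_max_left _ _)
  refine ⟨(hL₁ x hxb).trans l1, fun z hz => ?_⟩
  have hzb : x + z ∈ closedBall (0 : E n) (R + 1) := by
    simp only [mem_closedBall_zero_iff]
    linarith [norm_add_le x z]
  constructor
  · have := hconv.norm_image_sub_le_of_norm_fderiv_le (𝕜 := ℝ) (f := φ) (fun y _ => hd y)
      (fun y hy => (hL₁ y hy).trans l1) hxb hzb
    simpa using this
  · have hseg : segment ℝ x (x + z) ⊆ closedBall (0 : E n) (R + 1) := hconv.segment_subset hxb hzb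
    have hnear : ∀ y ∈ segment ℝ x (x + z), ‖y - x‖ ≤ ‖z‖ := by
      intro y hy
      have := norm_sub_le_of_mem_segment hy
      simpa using this
    have := (convex_segment x (x + z)).norm_image_sub_le_of_norm_fderiv_le' (𝕜 := ℝ) (f := φ)
      (φ := fderiv ℝ φ x) (C := max (max L₁ L₂) 0 * ‖z‖) (fun y _ => hd y)
      (fun y hy => ?_) (left_mem_segment ℝ x (x + z)) (right_mem_segment ℝ x (x + z))
    · rw [add_sub_cancel_left, mul_assoc, ← sq] at this
      simpa using this
    · refine (hconv.norm_image_sub_le_of_norm_fderiv_le (𝕜 := ℝ) (f := fderiv ℝ φ)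
        (fun y _ => hd1 y) (fun y hy => (hL₂ y hy).trans l2) hxb (hseg hy)).trans ?_
      exact mul_le_mul_of_nonneg_left (hnear y hy) (le_max_right _ _)

lemma exists_increment_le {n : ℕ} (σ : ℝ) {φ : E n → ℝ} (hφ : ContDiff ℝ 2 φ)
    (hφb : BoundedFun φ) {Ω : Set (E n)} (hΩ : Bornology.IsBounded Ω) :
    ∃ T, 0 ≤ T ∧ ∀ x ∈ Ω, ‖fderiv ℝ φ x‖ ≤ T ∧ ∀ z, |increment σ φ x z| ≤ T * growth σ z := by
  obtain ⟨L, hL, h⟩ := exists_taylor_bound hφ hΩ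
  obtain ⟨N, hN⟩ := hφb
  have hN0 : 0 ≤ N := (abs_nonneg _).trans (hN 0)
  refine ⟨L + 2 * N, by positivity, fun x hx => ?_⟩
  obtain ⟨h1, h2⟩ := h x hx
  refine ⟨by linarith, fun z => ?_⟩
  have hdiff : |φ (x + z) - φ x| ≤ 2 * N := by
    have := abs_sub (φ (x + z)) (φ x)
    linarith [hN (x + z), hN x]
  have hlin : |fderiv ℝ φ x z| ≤ L * ‖z‖ :=
    ((fderiv ℝ φ x).le_opNorm z).trans (mul_le_mul_of_nonneg_right h1 (norm_nonneg z))
  have hz0 := norm_nonneg z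
  unfold increment growth innerExp outerExp
  rcases lt_or_ge ‖z‖ 1 with hz | hz
  · obtain ⟨h3, h4⟩ := h2 z hz
    rw [if_pos hz]
    split_ifs with c1 c2
    · rw [Real.rpow_one]; nlinarith
    · rw [indicator_of_mem (mem_ball_zero_iff.2 hz), Real.rpow_two]
      nlinarith [sq_nonneg ‖z‖]
    · rw [Real.rpow_two]
      nlinarith [sq_nonneg ‖z‖]
  · rw [if_neg hz.not_gt]
    split_ifs with c1 c2 c3 c4 c5
    · linarith
    · rw [Real.rpow_zero]; linarith
    · linarith
    · rw [indicator_of_notMem (by simpa using hz), Real.rpow_zero, sub_zero]; linarith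
    · rw [Real.rpow_one]
      have := abs_sub (φ (x + z) - φ x) (fderiv ℝ φ x z)
      nlinarith
    · exact absurd (lt_of_le_of_ne (not_lt.1 c1) (Ne.symm c3)) c5

lemma measurable_increment {n : ℕ} (σ : ℝ) {φ : E n → ℝ} (hφ : Measurable φ) (x : E n) :
    Measurable (increment σ φ x) := by
  have : increment σ φ x = fun z => φ (x + z) - φ x - cutoff σ z * fderiv ℝ φ x z :=
    funext fun z => increment_eq σ φ x z
  rw [this]
  exact ((hφ.comp (measurable_const_add x)).sub_const _).sub
    ((measurable_cutoff σ).mul (fderiv ℝ φ x).measurable)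

lemma integrable_increment_mul {n : ℕ} {σ Λ : ℝ} (hσ0 : 0 < σ) (hσ2 : σ < 2) (hΛ : 0 < Λ)
    {φ : E n → ℝ} (hφ : ContDiff ℝ 2 φ) (hφb : BoundedFun φ) (x : E n) {k : E n → ℝ}
    (hk : IsKernel σ Λ k) : Integrable fun z => increment σ φ x z * k z := by
  obtain ⟨T, hT, h⟩ := exists_increment_le σ hφ hφb (Bornology.isBounded_singleton (x := x))
  obtain ⟨C, hC, hg⟩ := integrable_growth_mul (n := n) hσ0 hσ2 hΛ
  refine Integrable.mono ((hg k hk).1.const_mul T)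
    ((measurable_increment σ hφ.continuous.measurable x).mul hk.measurable).aestronglyMeasurable
    (Eventually.of_forall fun z => ?_)
  rw [norm_mul, Real.norm_of_nonneg (hk.nonneg z), Real.norm_of_nonneg
    (mul_nonneg hT (mul_nonneg (growth_nonneg σ z) (hk.nonneg z))), ← mul_assoc]
  exact mul_le_mul_of_nonneg_right ((h x rfl).2 z) (hk.nonneg z)

lemma abs_levyOp_sub_setIntegral_le {n : ℕ} {σ Λ : ℝ} (hσ0 : 0 < σ) (hσ2 : σ < 2) (hΛ : 0 < Λ)
    {φ : E n → ℝ} (hφ : ContDiff ℝ 2 φ) (hφb : BoundedFun φ) {x : E n} {k : E n → ℝ}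
    (hk : IsKernel σ Λ k) {T : ℝ} (hT : ∀ z, |increment σ φ x z| ≤ T * growth σ z)
    {S : Set (E n)} (hS : MeasurableSet S) :
    |levyOp σ k φ x - ∫ z in S, increment σ φ x z * k z| ≤
      T * ∫ z in Sᶜ, growth σ z * k z := by
  have hi := integrable_increment_mul hσ0 hσ2 hΛ hφ hφb x hk
  obtain ⟨C, hC, hg⟩ := integrable_growth_mul (n := n) hσ0 hσ2 hΛ
  rw [levyOp, ← integral_add_compl hS hi, add_sub_cancel_left, ← integral_const_mul]
  refine (abs_integral_le_integral_abs).trans ?_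
  refine integral_mono hi.integrableOn.abs ((hg k hk).1.const_mul T).integrableOn fun z => ?_
  change |increment σ φ x z * k z| ≤ T * (growth σ z * k z)
  rw [abs_mul, abs_of_nonneg (hk.nonneg z), ← mul_assoc]
  exact mul_le_mul_of_nonneg_right (hT z) (hk.nonneg z)

lemma exists_levyOp_le {n : ℕ} {σ Λ : ℝ} (hσ0 : 0 < σ) (hσ2 : σ < 2) (hΛ : 0 < Λ)
    {φ : E n → ℝ} (hφ : ContDiff ℝ 2 φ) (hφb : BoundedFun φ) {Ω : Set (E n)}
    (hΩ : Bornology.IsBounded Ω) : ∃ T, 0 ≤ T ∧ ∀ x ∈ Ω, ‖fderiv ℝ φ x‖ ≤ T ∧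
      ∀ k : E n → ℝ, IsKernel σ Λ k → |levyOp σ k φ x| ≤ T := by
  obtain ⟨T, hT, h⟩ := exists_increment_le σ hφ hφb hΩ
  obtain ⟨C, hC, hg⟩ := integrable_growth_mul (n := n) hσ0 hσ2 hΛ
  refine ⟨T + T * C, by positivity, fun x hx => ⟨by nlinarith [(h x hx).1], fun k hk => ?_⟩⟩
  have := abs_levyOp_sub_setIntegral_le hσ0 hσ2 hΛ hφ hφb hk (h x hx).2 MeasurableSet.empty
  simp only [setIntegral_empty, sub_zero, compl_empty, setIntegral_univ] at this
  nlinarith [mul_le_mul_of_nonneg_left (hg k hk).2.1 hT]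

lemma continuous_increment_left {n : ℕ} (σ : ℝ) {φ : E n → ℝ} (hφ : ContDiff ℝ 2 φ) (z : E n) :
    Continuous fun x => increment σ φ x z := by
  simp only [increment_eq]
  have h1 : Continuous (fderiv ℝ φ) := hφ.continuous_fderiv (by norm_num)
  have h2 := hφ.continuous
  fun_prop

/-- The Lévy operators are continuous in the base point, uniformly in the kernels of a family. -/
theorem tendsto_levyOp_sub {n : ℕ} {ι : Type*} {σ Λ : ℝ} (hσ0 : 0 < σ) (hσ2 : σ < 2)
    (hΛ : 0 < Λ) {Ω : Set (E n)} (hΩ : Bornology.IsBounded Ω) {K : ι → E n → E n → ℝ}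
    (hK : ∀ i, ∀ x ∈ Ω, IsKernel σ Λ (K i x))
    (hK_bdd : ∀ s R : ℝ, 0 < s → s < R →
      ∃ M : ℝ, ∀ i, ∀ x ∈ Ω, ∀ z : E n, s ≤ ‖z‖ → ‖z‖ ≤ R → K i x z ≤ M)
    (hK_cont : ∀ z : E n, z ≠ 0 → EquicontinuousOn (fun i x => K i x z) Ω)
    {φ : E n → ℝ} (hφ : ContDiff ℝ 2 φ) (hφb : BoundedFun φ) {x : E n} (hx : x ∈ Ω) :
    Tendsto (fun q : E n × ι => levyOp σ (K q.2 q.1) φ q.1 - levyOp σ (K q.2 x) φ x)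
      (𝓝[Ω] x ×ˢ ⊤) (𝓝 0) := by
  obtain ⟨T, hT, hTφ⟩ := exists_increment_le σ hφ hφb hΩ
  have hmemΩ : ∀ᶠ q : E n × ι in 𝓝[Ω] x ×ˢ ⊤, q.1 ∈ Ω :=
    tendsto_fst.eventually self_mem_nhdsWithin
  rw [Metric.tendsto_nhds]
  intro ε hε
  obtain ⟨s, R, hs, hsR, htail⟩ := exists_tail_le (n := n) hσ0 hσ2 hΛ
    (show 0 < ε / (4 * (T + 1)) by positivity)
  obtain ⟨M, hM⟩ := hK_bdd s R hs hsR
  set S : Set (E n) := ball 0 R \ ball 0 s with hS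
  have hSm : MeasurableSet S := measurableSet_ball.diff measurableSet_ball
  have hSnorm : ∀ z ∈ S, s ≤ ‖z‖ ∧ ‖z‖ < R := fun z hz =>
    ⟨by simpa using hz.2, by simpa using hz.1⟩
  have hKabs : ∀ i, ∀ y ∈ Ω, ∀ z ∈ S, |K i y z| ≤ M := fun i y hy z hz => by
    rw [abs_of_nonneg ((hK i y hy).nonneg z)]
    exact hM i y hy z (hSnorm z hz).1 (hSnorm z hz).2.le
  have hSfin : volume S ≠ ⊤ := (measure_mono (Set.sdiff_subset)).trans_lt
    (measure_ball_lt_top (x := (0 : E n)) (r := R)) |>.ne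
  have hG : ∀ z ∈ S, growth σ z ≤ 1 + R ^ outerExp σ := by
    intro z hz
    have hR0 : 0 ≤ R ^ outerExp σ := Real.rpow_nonneg (by linarith) _
    unfold growth
    split_ifs with h1
    · have := Real.rpow_le_one (norm_nonneg z) h1.le (zero_le_one.trans (one_le_innerExp σ))
      linarith
    · have := Real.rpow_le_rpow (norm_nonneg z) (hSnorm z hz).2.le (outerExp_nonneg σ)
      linarith
  have hmid : Tendsto (fun q : E n × ι => ∫ z in S, (increment σ φ q.1 z * K q.2 q.1 z
      - increment σ φ x z * K q.2 x z)) (𝓝[Ω] x ×ˢ ⊤) (𝓝 (∫ z in S, (0 : ℝ))) := by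
    refine tendsto_integral_filter_of_dominated_convergence
      (fun _ => 2 * (T * (1 + R ^ outerExp σ) * M)) ?_ ?_ ?_ ?_
    · filter_upwards [hmemΩ] with q hq
      exact (((measurable_increment σ hφ.continuous.measurable _).mul (hK _ _ hq).measurable).sub
        ((measurable_increment σ hφ.continuous.measurable _).mul
          (hK _ _ hx).measurable)).aestronglyMeasurable
    · filter_upwards [hmemΩ] with q hq
      refine (ae_restrict_iff' hSm).2 (Eventually.of_forall fun z hz => ?_)
      have hM0 : 0 ≤ M := (abs_nonneg _).trans (hKabs q.2 x hx z hz)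
      have hb : ∀ y ∈ Ω, |increment σ φ y z * K q.2 y z| ≤ T * (1 + R ^ outerExp σ) * M := by
        intro y hy
        rw [abs_mul]
        refine mul_le_mul (((hTφ y hy).2 z).trans (mul_le_mul_of_nonneg_left (hG z hz) hT))
          (hKabs q.2 y hy z hz) (abs_nonneg _) ?_
        have : 0 ≤ R ^ outerExp σ := Real.rpow_nonneg (by linarith) _
        positivity
      refine (norm_sub_le _ _).trans ?_
      simp only [Real.norm_eq_abs]
      linarith [hb q.1 hq, hb x hx]
    · exact integrableOn_const hSfin
    · refine (ae_restrict_iff' hSm).2 (Eventually.of_forall fun z hz => ?_)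
      have hz0 : z ≠ 0 := norm_pos_iff.1 (hs.trans_le (hSnorm z hz).1)
      have t1 : Tendsto (fun q : E n × ι => increment σ φ q.1 z - increment σ φ x z)
          (𝓝[Ω] x ×ˢ ⊤) (𝓝 0) := by
        have := ((continuous_increment_left σ hφ z).tendsto x).mono_left
          (nhdsWithin_le_nhds (s := Ω))
        have := (this.comp (tendsto_fst (g := (⊤ : Filter ι)))).sub_const (increment σ φ x z)
        simpa using this
      have t2 : Tendsto (fun q : E n × ι => K q.2 q.1 z - K q.2 x z) (𝓝[Ω] x ×ˢ ⊤) (𝓝 0) := by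
        rw [Metric.tendsto_nhds]
        intro e he
        have h1 := hK_cont z hz0 x hx _ (Metric.dist_mem_uniformity he)
        have h2 := (tendsto_fst (f := 𝓝[Ω] x) (g := (⊤ : Filter ι))).eventually h1
        filter_upwards [h2] with q hq
        rw [dist_zero_right, ← dist_eq_norm, dist_comm]
        exact hq q.2
      have b1 : ∀ᶠ q : E n × ι in 𝓝[Ω] x ×ˢ ⊤, |K q.2 q.1 z| ≤ M := by
        filter_upwards [hmemΩ] with q hq using hKabs _ _ hq z hz
      have e1 : Tendsto (fun q : E n × ι => (increment σ φ q.1 z - increment σ φ x z)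
          * K q.2 q.1 z) (𝓝[Ω] x ×ˢ ⊤) (𝓝 0) :=
        t1.zero_mul_isBoundedUnder_le ⟨M, eventually_map.2 b1⟩
      have e2 := e1.add (t2.const_mul (increment σ φ x z))
      simp only [mul_zero, add_zero] at e2
      refine e2.congr fun q => ?_
      ring
  rw [integral_zero] at hmid
  filter_upwards [hmemΩ, Metric.tendsto_nhds.1 hmid (ε / 2) (by positivity)] with q hq hq2
  rw [dist_zero_right, Real.norm_eq_abs] at hq2 ⊢
  have i1 := integrable_increment_mul hσ0 hσ2 hΛ hφ hφb q.1 (hK q.2 q.1 hq)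
  have i2 := integrable_increment_mul hσ0 hσ2 hΛ hφ hφb x (hK q.2 x hx)
  rw [integral_sub i1.integrableOn i2.integrableOn] at hq2
  have c1 := abs_levyOp_sub_setIntegral_le hσ0 hσ2 hΛ hφ hφb (hK q.2 q.1 hq) (hTφ q.1 hq).2 hSm
  have c2 := abs_levyOp_sub_setIntegral_le hσ0 hσ2 hΛ hφ hφb (hK q.2 x hx) (hTφ x hx).2 hSm
  have hT4 : T * (ε / (4 * (T + 1))) ≤ ε / 4 := by
    rw [mul_div_assoc', div_le_div_iff₀ (by positivity) (by positivity)]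
    nlinarith
  have d1 := mul_le_mul_of_nonneg_left (htail _ (hK q.2 q.1 hq)) hT
  have d2 := mul_le_mul_of_nonneg_left (htail _ (hK q.2 x hx)) hT
  rw [abs_lt] at hq2 ⊢
  have c1' := abs_le.1 (c1.trans (d1.trans hT4))
  have c2' := abs_le.1 (c2.trans (d2.trans hT4))
  constructor <;> linarith [c1'.1, c1'.2, c2'.1, c2'.2, hq2.1, hq2.2]

end NonlocalIsaacs
namespace NonlocalIsaacs

/-! ### The Isaacs operator is elliptic -/

section IsaacsOp

variable {A B : Type*} [Nonempty A] [Nonempty B]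

lemma iSup_iInf_le_add {X Y : A → B → ℝ} {M δ : ℝ} (hX : ∀ a b, |X a b| ≤ M)
    (hY : ∀ a b, |Y a b| ≤ M) (h : ∀ a b, X a b ≤ Y a b + δ) :
    ⨆ a, ⨅ b, X a b ≤ (⨆ a, ⨅ b, Y a b) + δ := by
  have hbX : ∀ a, BddBelow (range (X a)) := fun a =>
    ⟨-M, by rintro _ ⟨b, rfl⟩; exact (abs_le.1 (hX a b)).1⟩
  have hbY : ∀ a, BddBelow (range (Y a)) := fun a =>
    ⟨-M, by rintro _ ⟨b, rfl⟩; exact (abs_le.1 (hY a b)).1⟩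
  have hY' : BddAbove (range fun a => ⨅ b, Y a b) := by
    refine ⟨M, ?_⟩
    rintro _ ⟨a, rfl⟩
    obtain ⟨b⟩ := ‹Nonempty B›
    exact (ciInf_le (hbY a) b).trans (abs_le.1 (hY a b)).2
  refine ciSup_le fun a => ?_
  have h1 : (⨅ b, X a b) - δ ≤ ⨅ b, Y a b := le_ciInf fun b => by
    linarith [ciInf_le (hbX a) b, h a b]
  linarith [le_ciSup hY' a]

lemma abs_iSup_iInf_sub_le {X Y : A → B → ℝ} {M N δ : ℝ} (hX : ∀ a b, |X a b| ≤ M)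
    (hY : ∀ a b, |Y a b| ≤ N) (h : ∀ a b, |X a b - Y a b| ≤ δ) :
    |(⨆ a, ⨅ b, X a b) - ⨆ a, ⨅ b, Y a b| ≤ δ := by
  have hX' : ∀ a b, |X a b| ≤ max M N := fun a b => (hX a b).trans (le_max_left _ _)
  have hY' : ∀ a b, |Y a b| ≤ max M N := fun a b => (hY a b).trans (le_max_right _ _)
  have h1 := iSup_iInf_le_add hX' hY' fun a b => by linarith [(abs_le.1 (h a b)).2]
  have h2 := iSup_iInf_le_add hY' hX' fun a b => by linarith [(abs_le.1 (h a b)).1]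
  exact abs_le.2 ⟨by linarith, by linarith⟩

lemma fderiv_eq_of_sub_le {n : ℕ} {φ ψ : E n → ℝ} {x : E n} (hφ : DifferentiableAt ℝ φ x)
    (hψ : DifferentiableAt ℝ ψ x) (h : ∀ᶠ y in 𝓝 x, φ y - φ x ≤ ψ y - ψ x) :
    fderiv ℝ φ x = fderiv ℝ ψ x := by
  have hmin : IsLocalMin (fun y => ψ y - φ y) x := by
    filter_upwards [h] with y hy
    linarith
  have := hmin.fderiv_eq_zero
  rw [fderiv_fun_sub hψ hφ, sub_eq_zero] at this
  exact this.symm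

lemma increment_le_increment {n : ℕ} (σ : ℝ) {φ ψ : E n → ℝ} {x : E n}
    (hφ : DifferentiableAt ℝ φ x) (hψ : DifferentiableAt ℝ ψ x)
    (h : ∀ y, φ y - φ x ≤ ψ y - ψ x) (z : E n) :
    increment σ φ x z ≤ increment σ ψ x z := by
  rw [increment_eq, increment_eq, fderiv_eq_of_sub_le hφ hψ (Eventually.of_forall h)]
  linarith [h (x + z)]

lemma increment_add_mul {n : ℕ} (σ : ℝ) {φ η : E n → ℝ} {x : E n}
    (hφ : DifferentiableAt ℝ φ x) (hη : DifferentiableAt ℝ η x) (t : ℝ) (z : E n) :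
    increment σ (fun y => φ y + t * η y) x z = increment σ φ x z + t * increment σ η x z := by
  rw [increment_eq, increment_eq, increment_eq, fderiv_fun_add hφ (hη.const_mul t),
    fderiv_const_mul hη]
  simp only [_root_.add_apply, _root_.smul_apply, smul_eq_mul]
  ring

/-- The Isaacs operator with bounded equicontinuous coefficients is elliptic. -/
theorem isEllipticOn_isaacsOp {n : ℕ} {Ω : Set (E n)} (hΩ_bdd : Bornology.IsBounded Ω)
    {σ Λ : ℝ} (hσ0 : 0 < σ) (hσ2 : σ < 2) (hΛ : 0 < Λ)
    {K : A → B → E n → E n → ℝ} {b : A → B → E n → E n} {c f : A → B → E n → ℝ}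
    (hK_bdd : ∀ s R : ℝ, 0 < s → s < R →
      ∃ M : ℝ, ∀ α β, ∀ x ∈ Ω, ∀ z : E n, s ≤ ‖z‖ → ‖z‖ ≤ R → K α β x z ≤ M)
    (hb_bdd : ∃ M : ℝ, ∀ α β, ∀ x ∈ Ω, ‖b α β x‖ ≤ M)
    (hc_bdd : ∃ M : ℝ, ∀ α β, ∀ x ∈ Ω, |c α β x| ≤ M)
    (hf_bdd : ∃ M : ℝ, ∀ α β, ∀ x ∈ Ω, |f α β x| ≤ M)
    (hK_cont : ∀ z : E n, z ≠ 0 →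
      EquicontinuousOn (fun (p : A × B) (x : E n) => K p.1 p.2 x z) Ω)
    (hb_cont : EquicontinuousOn (fun p : A × B => b p.1 p.2) Ω)
    (hc_cont : EquicontinuousOn (fun p : A × B => c p.1 p.2) Ω)
    (hf_cont : EquicontinuousOn (fun p : A × B => f p.1 p.2) Ω)
    (hK : ∀ α β, ∀ x ∈ Ω, IsKernel σ Λ (K α β x)) :
    IsEllipticOn (isaacsOp σ K b c f) Ω := by
  obtain ⟨Mb, hMb⟩ := hb_bdd
  obtain ⟨Mc, hMc⟩ := hc_bdd
  obtain ⟨Mf, hMf⟩ := hf_bdd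
  have bound : ∀ φ : E n → ℝ, ContDiff ℝ 2 φ → BoundedFun φ → ∀ x ∈ Ω, ∀ r, ∃ M, ∀ α β,
      |-levyOp σ (K α β x) φ x + fderiv ℝ φ x (b α β x) + c α β x * r + f α β x| ≤ M := by
    intro φ hφ hφb x hx r
    obtain ⟨T, hT, h⟩ := exists_levyOp_le hσ0 hσ2 hΛ hφ hφb hΩ_bdd
    refine ⟨T + T * Mb + Mc * |r| + Mf, fun α β => ?_⟩
    refine (abs_add_le _ _).trans (add_le_add ((abs_add_le _ _).trans (add_le_add
      ((abs_add_le _ _).trans (add_le_add ?_ ?_)) ?_)) (hMf α β x hx))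
    · rw [abs_neg]; exact (h x hx).2 _ (hK α β x hx)
    · exact ((fderiv ℝ φ x).le_opNorm _).trans
        (mul_le_mul (h x hx).1 (hMb α β x hx) (norm_nonneg _) hT)
    · rw [abs_mul]; exact mul_le_mul_of_nonneg_right (hMc α β x hx) (abs_nonneg r)
  refine ⟨fun φ ψ hφ hφb hψ hψb x hx r h => ?_, fun φ hφ hφb x hx r => ?_,
    fun φ η hφ hφb hη hηb => ?_⟩
  · obtain ⟨M, hM⟩ := bound φ hφ hφb x hx r
    obtain ⟨N, hN⟩ := bound ψ hψ hψb x hx r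
    have dφ := (hφ.differentiable (by norm_num)) x
    have dψ := (hψ.differentiable (by norm_num)) x
    have := iSup_iInf_le_add (δ := 0) (fun α β => (hN α β).trans (le_max_right M N))
      (fun α β => (hM α β).trans (le_max_left M N)) fun α β => ?_
    · simpa [isaacsOp] using this
    · have hk := hK α β x hx
      have : levyOp σ (K α β x) φ x ≤ levyOp σ (K α β x) ψ x :=
        integral_mono (integrable_increment_mul hσ0 hσ2 hΛ hφ hφb x hk)
          (integrable_increment_mul hσ0 hσ2 hΛ hψ hψb x hk) fun z =>
          mul_le_mul_of_nonneg_right (increment_le_increment σ dφ dψ h z) (hk.nonneg z)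
      rw [fderiv_eq_of_sub_le dφ dψ (Eventually.of_forall h)]
      linarith
  · have hlevy := tendsto_levyOp_sub (ι := A × B) (K := fun p => K p.1 p.2) hσ0 hσ2 hΛ hΩ_bdd
      (fun p => hK p.1 p.2) (fun s R hs hsR => (hK_bdd s R hs hsR).imp fun M hM p => hM p.1 p.2)
      hK_cont hφ hφb hx
    rw [Metric.continuousWithinAt_iff']
    intro ε hε
    rw [nhdsWithin_prod_eq, nhdsWithin_univ]
    obtain ⟨T, hT, hTφ⟩ := exists_levyOp_le hσ0 hσ2 hΛ hφ hφb hΩ_bdd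
    set e := ε / 10 with he
    have he0 : 0 < e := by positivity
    have h1 : ∀ᶠ y in 𝓝[Ω] x, ∀ p : A × B,
        |levyOp σ (K p.1 p.2 y) φ y - levyOp σ (K p.1 p.2 x) φ x| < e := by
      have := (Metric.tendsto_nhds.1 hlevy e he0)
      rw [eventually_prod_iff] at this
      obtain ⟨pa, hpa, pb, hpb, hp⟩ := this
      filter_upwards [hpa] with y hy p
      have := hp hy (eventually_top.1 hpb p)
      rwa [dist_zero_right, Real.norm_eq_abs] at this
    have h2 : ∀ᶠ y in 𝓝[Ω] x, ‖fderiv ℝ φ y - fderiv ℝ φ x‖ < e / (|Mb| + 1) := by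
      have hc : Continuous (fderiv ℝ φ) := hφ.continuous_fderiv (by norm_num)
      have := (Metric.tendsto_nhds.1 (hc.tendsto x) (e / (|Mb| + 1)) (by positivity))
      simpa only [dist_eq_norm] using this.filter_mono nhdsWithin_le_nhds
    have h3 : ∀ᶠ y in 𝓝[Ω] x, ∀ p : A × B, ‖b p.1 p.2 y - b p.1 p.2 x‖ < e / (T + 1) := by
      filter_upwards [hb_cont x hx _ (Metric.dist_mem_uniformity
        (show 0 < e / (T + 1) by positivity))] with y hy p
      have : dist (b p.1 p.2 x) (b p.1 p.2 y) < e / (T + 1) := hy p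
      rwa [dist_comm, dist_eq_norm] at this
    have h4 : ∀ᶠ y in 𝓝[Ω] x, ∀ p : A × B, |c p.1 p.2 y - c p.1 p.2 x| < e / (|r| + 1) := by
      filter_upwards [hc_cont x hx _ (Metric.dist_mem_uniformity
        (show 0 < e / (|r| + 1) by positivity))] with y hy p
      have : dist (c p.1 p.2 x) (c p.1 p.2 y) < e / (|r| + 1) := hy p
      rwa [dist_comm, Real.dist_eq] at this
    have h5 : ∀ᶠ y in 𝓝[Ω] x, ∀ p : A × B, |f p.1 p.2 y - f p.1 p.2 x| < e := by
      filter_upwards [hf_cont x hx _ (Metric.dist_mem_uniformity he0)] with y hy p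
      have : dist (f p.1 p.2 x) (f p.1 p.2 y) < e := hy p
      rwa [dist_comm, Real.dist_eq] at this
    have h6 : ∀ᶠ s in 𝓝 r, |s - r| < e / (|Mc| + 1) :=
      Metric.ball_mem_nhds r (by positivity)
    have hmem : ∀ᶠ y in 𝓝[Ω] x, y ∈ Ω := self_mem_nhdsWithin
    filter_upwards [(((h1.and h2).and (h3.and h4)).and (h5.and hmem)).prod_mk h6]
    rintro ⟨y, s⟩ ⟨⟨⟨⟨g1, g2⟩, g3, g4⟩, g5, hy⟩, g6⟩
    dsimp only at g1 g2 g3 g4 g5 g6 hy ⊢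
    rw [Real.dist_eq]
    obtain ⟨M, hM⟩ := bound φ hφ hφb y hy s
    obtain ⟨N, hN⟩ := bound φ hφ hφb x hx r
    have : |isaacsOp σ K b c f y s φ - isaacsOp σ K b c f x r φ| ≤ 6 * e := by
      refine abs_iSup_iInf_sub_le hM hN fun α β => ?_
      have k1 := (g1 (α, β)).le
      have k2 : |(fderiv ℝ φ y - fderiv ℝ φ x) (b α β y)| ≤ e := by
        refine ((fderiv ℝ φ y - fderiv ℝ φ x).le_opNorm _).trans ?_
        have hb1 : ‖b α β y‖ ≤ |Mb| + 1 := by linarith [hMb α β y hy, le_abs_self Mb]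
        refine (mul_le_mul g2.le hb1 (norm_nonneg _) (by positivity)).trans_eq ?_
        field_simp
      have k3 : |fderiv ℝ φ x (b α β y - b α β x)| ≤ e := by
        refine ((fderiv ℝ φ x).le_opNorm _).trans ?_
        have ht1 : ‖fderiv ℝ φ x‖ ≤ T + 1 := by linarith [(hTφ x hx).1]
        refine (mul_le_mul ht1 (g3 (α, β)).le (norm_nonneg _) (by positivity)).trans_eq ?_
        field_simp
      have k4 : |(c α β y - c α β x) * r| ≤ e := by
        rw [abs_mul]
        have hr1 : |r| ≤ |r| + 1 := by linarith
        refine (mul_le_mul (g4 (α, β)).le hr1 (abs_nonneg _) (by positivity)).trans_eq ?_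
        field_simp
      have k5 : |c α β y * (s - r)| ≤ e := by
        rw [abs_mul]
        have hc1 : |c α β y| ≤ |Mc| + 1 := by linarith [hMc α β y hy, le_abs_self Mc]
        refine (mul_le_mul hc1 g6.le (abs_nonneg _) (by positivity)).trans_eq ?_
        field_simp
      have k6 := (g5 (α, β)).le
      dsimp only at k1 k6
      rw [_root_.sub_apply] at k2
      rw [map_sub] at k3
      rw [abs_le] at k1 k2 k3 k4 k5 k6 ⊢
      constructor <;> nlinarith
    linarith
  · obtain ⟨T, hT, h⟩ := exists_levyOp_le hσ0 hσ2 hΛ hη hηb hΩ_bdd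
    refine ⟨T + T * |Mb|, fun x hx r t => ?_⟩
    obtain ⟨M, hM⟩ := bound _ (hφ.add (contDiff_const (c := t).mul hη)) (hφb.add (hηb.const_mul t))
      x hx r
    obtain ⟨N, hN⟩ := bound φ hφ hφb x hx r
    refine abs_iSup_iInf_sub_le hM hN fun α β => ?_
    have hk := hK α β x hx
    have dφ := (hφ.differentiable (by norm_num)) x
    have dη := (hη.differentiable (by norm_num)) x
    have e1 : levyOp σ (K α β x) (fun y => φ y + t * η y) x =
        levyOp σ (K α β x) φ x + t * levyOp σ (K α β x) η x := by
      simp only [levyOp, increment_add_mul σ dφ dη, add_mul, mul_assoc]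
      rw [integral_add (integrable_increment_mul hσ0 hσ2 hΛ hφ hφb x hk)
        ((integrable_increment_mul hσ0 hσ2 hΛ hη hηb x hk).const_mul t), integral_const_mul]
    have e2 : fderiv ℝ (fun y => φ y + t * η y) x (b α β x) =
        fderiv ℝ φ x (b α β x) + t * fderiv ℝ η x (b α β x) := by
      rw [fderiv_fun_add dφ (dη.const_mul t), fderiv_const_mul dη]
      simp
    rw [e1, e2]
    have e3 : -(levyOp σ (K α β x) φ x + t * levyOp σ (K α β x) η x) +
        (fderiv ℝ φ x (b α β x) + t * fderiv ℝ η x (b α β x)) + c α β x * r + f α β x -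
        (-levyOp σ (K α β x) φ x + fderiv ℝ φ x (b α β x) + c α β x * r + f α β x) =
        t * (-levyOp σ (K α β x) η x + fderiv ℝ η x (b α β x)) := by ring
    rw [e3, abs_mul, mul_comm]
    refine mul_le_mul_of_nonneg_right ((abs_add_le _ _).trans (add_le_add ?_ ?_)) (abs_nonneg t)
    · rw [abs_neg]; exact (h x hx).2 _ hk
    · exact ((fderiv ℝ η x).le_opNorm _).trans (mul_le_mul (h x hx).1
        ((hMb α β x hx).trans (le_abs_self _)) (norm_nonneg _) hT)

end IsaacsOp

end NonlocalIsaacs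
namespace NonlocalIsaacs

/-! ### Powers of the distance to a ball -/

lemma rpow_le_tangent {t d a : ℝ} (ht : 0 ≤ t) (hd : 0 < d) (ha0 : 0 ≤ a) (ha1 : a ≤ 1) :
    t ^ a ≤ d ^ a + a * d ^ (a - 1) * (t - d) := by
  have h := rpow_one_add_le_one_add_mul_self (s := t / d - 1)
    (by have : 0 ≤ t / d := by positivity
        linarith) ha0 ha1
  rw [add_sub_cancel, Real.div_rpow ht hd.le, div_le_iff₀ (by positivity)] at h
  rw [Real.rpow_sub_one hd.ne']
  calc t ^ a ≤ _ := h
    _ = _ := by field_simp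

lemma rpow_add_le_growth {x d a θ : ℝ} (hd : 0 < d) (hx : d / 2 ≤ x) (ha0 : 0 < a)
    (haθ : a ≤ θ) : (d + x) ^ a ≤ d ^ a + a / θ * 3 ^ θ * d ^ (a - θ) * x ^ θ := by
  have hθ : 0 < θ := ha0.trans_le haθ
  have hx0 : 0 < x := by linarith
  have h1 : (0 : ℝ) ≤ (1 + x / d) ^ θ := by positivity
  have h := rpow_one_add_le_one_add_mul_self (s := (1 + x / d) ^ θ - 1) (p := a / θ)
    (by linarith) (by positivity) ((div_le_one hθ).2 haθ)
  rw [add_sub_cancel, ← Real.rpow_mul (by positivity), mul_div_cancel₀ _ hθ.ne'] at h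
  have h2 : (1 + x / d) ^ θ ≤ 3 ^ θ * (d ^ (-θ) * x ^ θ) := by
    rw [Real.rpow_neg hd.le, ← div_eq_inv_mul, ← Real.div_rpow hx0.le hd.le,
      ← Real.mul_rpow (by norm_num) (by positivity)]
    refine Real.rpow_le_rpow (by positivity) ?_ hθ.le
    rw [mul_div_assoc', ← sub_nonneg]
    have : 3 * x / d - (1 + x / d) = (2 * x - d) / d := by field_simp; ring
    rw [this]
    exact div_nonneg (by linarith) hd.le
  have h3 : (1 + x / d) ^ a ≤ 1 + a / θ * (3 ^ θ * (d ^ (-θ) * x ^ θ)) := by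
    have : 0 ≤ a / θ := by positivity
    nlinarith [mul_le_mul_of_nonneg_left h2 this]
  have e : (d + x) ^ a = d ^ a * (1 + x / d) ^ a := by
    rw [← Real.mul_rpow hd.le (by positivity)]
    congr 1
    field_simp
  have e2 : d ^ (a - θ) = d ^ a * d ^ (-θ) := by rw [sub_eq_add_neg, Real.rpow_add hd]
  rw [e, e2]
  calc _ ≤ d ^ a * (1 + a / θ * (3 ^ θ * (d ^ (-θ) * x ^ θ))) :=
        mul_le_mul_of_nonneg_left h3 (by positivity)
    _ = _ := by ring

lemma norm_add_le_tangent {n : ℕ} {v : E n} (hv : v ≠ 0) (z : E n) :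
    ‖v + z‖ ≤ ‖v‖ + inner ℝ (‖v‖⁻¹ • v) z + ‖z‖ ^ 2 / (2 * ‖v‖) := by
  have hv0 : 0 < ‖v‖ := norm_pos_iff.2 hv
  have h1 := norm_add_sq_real v z
  have e : ‖v‖ + inner ℝ (‖v‖⁻¹ • v) z + ‖z‖ ^ 2 / (2 * ‖v‖) =
      (‖v + z‖ ^ 2 + ‖v‖ ^ 2) / (2 * ‖v‖) := by
    rw [real_inner_smul_left, h1]
    field_simp
    ring
  rw [e, le_div_iff₀ (by positivity)]
  nlinarith [sq_nonneg (‖v + z‖ - ‖v‖)]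

lemma rpow_le_four_mul {s d q : ℝ} (hd : 0 < d) (h1 : d / 2 ≤ s) (h2 : s ≤ d) (hq : |q| ≤ 2) :
    s ^ q ≤ 4 * d ^ q := by
  have hs : 0 < s := by linarith
  have hdq : 0 < d ^ q := by positivity
  rcases le_total 0 q with h | h
  · have := Real.rpow_le_rpow hs.le h2 h
    linarith
  · have h3 : s ^ q ≤ (d / 2) ^ q := Real.rpow_le_rpow_of_nonpos (by positivity) h1 h
    have h4 : (d / 2) ^ q = d ^ q * 2 ^ (-q) := by
      rw [Real.div_rpow hd.le (by norm_num), Real.rpow_neg (by norm_num), div_eq_mul_inv]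
    have h5 : (2 : ℝ) ^ (-q) ≤ 2 ^ (2 : ℝ) :=
      Real.rpow_le_rpow_of_exponent_le (by norm_num) (by linarith [neg_abs_le q])
    rw [h4] at h3
    have h6 : (2 : ℝ) ^ (2 : ℝ) = 4 := by norm_num
    rw [h6] at h5
    nlinarith

/-- The power `a` of the distance to the ball of radius `r` about `y`. -/
noncomputable def ballBarrier {n : ℕ} (y : E n) (r a : ℝ) (w : E n) : ℝ :=
  (max (‖w - y‖ - r) 0) ^ a

lemma ballBarrier_nonneg {n : ℕ} (y : E n) (r a : ℝ) (w : E n) : 0 ≤ ballBarrier y r a w := by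
  unfold ballBarrier; positivity

lemma continuous_ballBarrier {n : ℕ} (y : E n) (r : ℝ) {a : ℝ} (ha : 0 ≤ a) :
    Continuous (ballBarrier y r a) := by
  unfold ballBarrier
  exact Continuous.rpow_const (by fun_prop) fun _ => Or.inr ha

lemma hasFDerivAt_ballBarrier {n : ℕ} {y w : E n} {r a : ℝ} (hr : 0 < r) (hd : 0 < ‖w - y‖ - r) :
    HasFDerivAt (ballBarrier y r a) ((a * (‖w - y‖ - r) ^ (a - 1)) •
      innerSL ℝ (‖w - y‖⁻¹ • (w - y))) w := by
  have hv : 0 < ‖w - y‖ := by linarith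
  have h1 : HasFDerivAt (fun x : E n => ‖x - y‖ ^ 2) (2 • innerSL ℝ (w - y)) w := by
    have := (hasStrictFDerivAt_norm_sq (w - y)).hasFDerivAt.comp w
      ((hasFDerivAt_id w).sub_const y)
    rwa [ContinuousLinearMap.comp_id] at this
  have h2 : HasFDerivAt (fun x : E n => ‖x - y‖) (innerSL ℝ (‖w - y‖⁻¹ • (w - y))) w := by
    have := h1.sqrt (by positivity)
    simp only [Real.sqrt_sq (norm_nonneg _)] at this
    refine this.congr_fderiv ?_
    rw [map_smul, two_nsmul, ← two_smul ℝ, smul_smul]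
    congr 1
    field_simp
  have h3 := (h2.sub_const r).rpow_const (p := a) (Or.inl hd.ne')
  refine h3.congr_of_eventuallyEq ?_
  have hc : ContinuousAt (fun x : E n => ‖x - y‖ - r) w := by fun_prop
  filter_upwards [hc.eventually (eventually_gt_nhds hd)] with x hx
  rw [ballBarrier, max_eq_left hx.le]

/-- The increments of the barrier near the origin. -/
lemma ballBarrier_near {n : ℕ} {y w z : E n} {r a : ℝ} (hr : 0 < r) (ha0 : 0 < a) (ha1 : a ≤ 1)
    (σ : ℝ) (hd : 0 < ‖w - y‖ - r) (hz : ‖z‖ < ‖w - y‖ - r) (hz1 : ‖z‖ < 1) :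
    increment σ (ballBarrier y r a) w z ≤
      a * (‖w - y‖ - r) ^ (a - 1) * (1 + 1 / (2 * r)) * ‖z‖ ^ innerExp σ := by
  set d := ‖w - y‖ - r with hdef
  have hv : 0 < ‖w - y‖ := by linarith
  have hP : 0 ≤ a * d ^ (a - 1) := by positivity
  have ht : 0 ≤ ‖w + z - y‖ - r := by
    have : ‖w - y‖ - ‖z‖ ≤ ‖w + z - y‖ := by
      have := norm_sub_norm_le (w - y) (-z)
      rw [norm_neg, sub_neg_eq_add] at this
      rwa [add_sub_right_comm]
    linarith
  have htan := rpow_le_tangent ht hd ha0.le ha1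
  have e1 : ballBarrier y r a (w + z) = (‖w + z - y‖ - r) ^ a := by
    rw [ballBarrier, max_eq_left ht]
  have e2 : ballBarrier y r a w = d ^ a := by rw [ballBarrier, max_eq_left hd.le]
  have hz0 := norm_nonneg z
  have hr2 : 0 < 1 / (2 * r) := by positivity
  rw [increment_eq, (hasFDerivAt_ballBarrier hr hd).fderiv, e1, e2]
  simp only [_root_.smul_apply, innerSL_apply_apply, smul_eq_mul]
  have e3 : ‖w + z - y‖ - r - d = ‖(w - y) + z‖ - ‖w - y‖ := by
    rw [hdef, add_sub_right_comm]; ring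
  rw [e3] at htan
  unfold innerExp
  rcases lt_or_ge σ 1 with h | h
  · have hc : cutoff σ z = 0 := by simp [cutoff, h]
    rw [if_pos h, hc, Real.rpow_one]
    have h1 : ‖(w - y) + z‖ - ‖w - y‖ ≤ ‖z‖ := by linarith [norm_add_le (w - y) z]
    have h2 := mul_le_mul_of_nonneg_left h1 hP
    have h3 : 0 ≤ a * d ^ (a - 1) * (1 / (2 * r)) * ‖z‖ := by positivity
    linarith
  · have hc : cutoff σ z = 1 := by
      unfold cutoff
      rw [if_neg h.not_gt]
      split_ifs
      · rw [indicator_of_mem (mem_ball_zero_iff.2 hz1)]; rfl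
      · rfl
    rw [if_neg h.not_gt, hc, Real.rpow_two]
    have h1 := norm_add_le_tangent (norm_pos_iff.1 hv) z
    have h2 : ‖z‖ ^ 2 / (2 * ‖w - y‖) ≤ 1 / (2 * r) * ‖z‖ ^ 2 := by
      rw [div_eq_mul_inv, mul_comm, ← one_div]
      refine mul_le_mul_of_nonneg_right ?_ (by positivity)
      exact one_div_le_one_div_of_le (by positivity) (by linarith)
    have h3 : ‖(w - y) + z‖ - ‖w - y‖ - inner ℝ (‖w - y‖⁻¹ • (w - y)) z ≤
        (1 + 1 / (2 * r)) * ‖z‖ ^ 2 := by nlinarith [sq_nonneg ‖z‖]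
    have h4 := mul_le_mul_of_nonneg_left h3 hP
    linarith

/-- The increments of the barrier away from the origin. -/
lemma ballBarrier_far {n : ℕ} {y w z : E n} {r a θ : ℝ} (ha0 : 0 < a) (haθ : a ≤ θ)
    (hd : 0 < ‖w - y‖ - r) (hz : (‖w - y‖ - r) / 2 ≤ ‖z‖) :
    ballBarrier y r a (w + z) - ballBarrier y r a w ≤
      a / θ * 3 ^ θ * (‖w - y‖ - r) ^ (a - θ) * ‖z‖ ^ θ := by
  have e2 : ballBarrier y r a w = (‖w - y‖ - r) ^ a := by rw [ballBarrier, max_eq_left hd.le]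
  have h1 : ballBarrier y r a (w + z) ≤ ((‖w - y‖ - r) + ‖z‖) ^ a := by
    refine Real.rpow_le_rpow (le_max_right _ _) (max_le ?_ ?_) ha0.le
    · have := norm_add_le (w - y) z
      rw [← add_sub_right_comm] at this
      linarith
    · linarith [norm_nonneg z]
  have h2 := rpow_add_le_growth hd hz ha0 haθ
  rw [e2]
  linarith

/-- Jumps towards the ball decrease the barrier by a fixed factor. -/
lemma ballBarrier_inward {n : ℕ} {y w z : E n} {r a C : ℝ} (hr : 0 < r) (ha0 : 0 < a)
    (hd : 0 < ‖w - y‖ - r) (hC : 0 < C)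
    (hsmall : (C ^ 2 * (‖w - y‖ - r) / (2 * r)) ^ a ≤ 1 / 2)
    (hzν : inner ℝ z (‖w - y‖⁻¹ • (w - y)) < -(‖w - y‖ - r)) (hz : ‖z‖ < C * (‖w - y‖ - r)) :
    ballBarrier y r a (w + z) - ballBarrier y r a w ≤ -((‖w - y‖ - r) ^ a / 2) := by
  set d := ‖w - y‖ - r with hdef
  have hv : 0 < ‖w - y‖ := by linarith
  have e2 : ballBarrier y r a w = d ^ a := by rw [ballBarrier, max_eq_left hd.le]
  rw [real_inner_smul_right, inv_mul_lt_iff₀ hv] at hzν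
  have hsq : ‖w + z - y‖ ^ 2 ≤ r ^ 2 + C ^ 2 * d ^ 2 := by
    have h1 := norm_add_sq_real (w - y) z
    rw [real_inner_comm, ← add_sub_right_comm] at h1
    have h2 : ‖z‖ ^ 2 ≤ (C * d) ^ 2 := pow_le_pow_left₀ (norm_nonneg z) hz.le 2
    have hvd : ‖w - y‖ = r + d := by rw [hdef]; ring
    rw [hvd] at h1 hzν
    nlinarith [sq_nonneg d]
  have hnorm : ‖w + z - y‖ ≤ r + d * (C ^ 2 * d / (2 * r)) := by
    refine abs_le_of_sq_le_sq' ?_ (by positivity) |>.2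
    refine hsq.trans ?_
    have : (r + d * (C ^ 2 * d / (2 * r))) ^ 2 =
        r ^ 2 + C ^ 2 * d ^ 2 + (d * (C ^ 2 * d / (2 * r))) ^ 2 := by
      field_simp
      ring
    rw [this]
    linarith [sq_nonneg (d * (C ^ 2 * d / (2 * r)))]
  have h1 : ballBarrier y r a (w + z) ≤ (d * (C ^ 2 * d / (2 * r))) ^ a :=
    Real.rpow_le_rpow (le_max_right _ _) (max_le (by linarith) (by positivity)) ha0.le
  rw [Real.mul_rpow hd.le (by positivity)] at h1
  have h2 : 0 < d ^ a := by positivity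
  rw [e2]
  nlinarith

end NonlocalIsaacs
namespace NonlocalIsaacs

/-! ### The barrier at a boundary point -/

lemma volume_ball_toReal {n : ℕ} {d : ℝ} (hd : 0 < d) :
    (volume (ball (0 : E n) d)).toReal = d ^ n * (volume (ball (0 : E n) 1)).toReal := by
  rw [Measure.addHaar_ball_of_pos volume (0 : E n) hd, ENNReal.toReal_mul, finrank_euclideanSpace_fin,
    ENNReal.toReal_ofReal (by positivity)]

/-- The mass that a nondegenerate kernel gives to the inward jumps. -/
lemma le_setIntegral_inward {n : ℕ} {σ Λ lam μ d : ℝ} (hσ0 : 0 < σ) (hσ2 : σ < 2) (hΛ : 0 < Λ)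
    (hlam : 0 < lam) (hd : 0 < d) {k : E n → ℝ} (hk : IsKernel σ Λ k) {S : Set (E n)}
    (hSm : MeasurableSet S) {R : ℝ} (hSR : S ⊆ ball 0 R \ ball 0 d)
    (hS : ENNReal.ofReal μ * volume (ball (0 : E n) d) ≤ volume S)
    (hμ : 0 < μ) (hkS : ∀ z ∈ S, (2 - σ) * lam * d ^ (-(n : ℝ) - σ) ≤ k z) :
    IntegrableOn k S ∧
      (2 - σ) * lam * μ * (volume (ball (0 : E n) 1)).toReal * d ^ (-σ) ≤ ∫ z in S, k z := by
  obtain ⟨C, -, hC⟩ := exists_outer_moment_le n hσ2 hΛ le_rfl hσ0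
  have hi : IntegrableOn k S := by
    have := (hC k hk d hd).1
    simp only [Real.rpow_zero, one_mul] at this
    exact this.mono_set fun z hz => (hSR hz).2
  have hfin : volume S ≠ ⊤ :=
    ((measure_mono (hSR.trans Set.sdiff_subset)).trans_lt measure_ball_lt_top).ne
  refine ⟨hi, ?_⟩
  have h1 := setIntegral_ge_of_const_le hSm hfin hkS hi
  have h2 : μ * (d ^ n * (volume (ball (0 : E n) 1)).toReal) ≤ (volume S).toReal := by
    have := ENNReal.toReal_mono hfin hS
    rwa [ENNReal.toReal_mul, ENNReal.toReal_ofReal hμ.le, volume_ball_toReal hd] at this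
  have h2σ : 0 < 2 - σ := by linarith
  refine le_trans ?_ h1
  rw [Measure.real]
  refine le_trans (le_of_eq ?_) (mul_le_mul_of_nonneg_right h2 (by positivity))
  have : d ^ (-σ) = d ^ (-(n : ℝ) - σ) * d ^ n := by
    rw [← Real.rpow_natCast d n, ← Real.rpow_add hd]; congr 1; ring
  rw [this]
  ring

set_option maxHeartbeats 1000000 in
/-- Near the ball the barrier is a strict supersolution for all nondegenerate kernels. -/
theorem exists_ballBarrier_strict (n : ℕ) {σ Λ : ℝ} (hσ0 : 0 < σ) (hσ2 : σ < 2) (hΛ : 0 < Λ)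
    {r C lam μ Mb : ℝ} (hr : 0 < r) (hr1 : r ≤ 1) (hC : 0 < C) (hlam : 0 < lam)
    (hμ : 0 < μ) (hMb : 0 ≤ Mb) :
    ∃ a d₁ m : ℝ, 0 < a ∧ 0 < d₁ ∧ d₁ ≤ r ∧ 0 < m ∧ ∀ y w : E n, 0 < ‖w - y‖ - r →
      ‖w - y‖ - r < d₁ → ∀ k : E n → ℝ, IsKernel σ Λ k → ∀ S : Set (E n), MeasurableSet S →
      S ⊆ {z | inner ℝ z (‖w - y‖⁻¹ • (w - y)) < -(‖w - y‖ - r)} ∩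
        (ball 0 (C * (‖w - y‖ - r)) \ ball 0 (‖w - y‖ - r)) →
      ENNReal.ofReal μ * volume (ball (0 : E n) (‖w - y‖ - r)) ≤ volume S →
      (∀ z ∈ S, (2 - σ) * lam * (‖w - y‖ - r) ^ (-(n : ℝ) - σ) ≤ k z) →
      ∀ v : E n, ‖v‖ ≤ Mb → (σ < 1 → v = 0) →
      DifferentiableAt ℝ (ballBarrier y r a) w ∧ ∃ G : E n → ℝ, Integrable G ∧
        (∀ z, increment σ (ballBarrier y r a) w z * k z ≤ G z) ∧
        m ≤ -(∫ z, G z) + fderiv ℝ (ballBarrier y r a) w v := by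
  set θ := σ / 2 with hθ
  have hθ0 : 0 < θ := by positivity
  have h2σ : 0 < 2 - σ := by linarith
  obtain ⟨C₁, hC₁, hin⟩ := exists_inner_moment_le n hσ0 hσ2 hΛ (lt_innerExp hσ2)
  obtain ⟨C₂, hC₂, hout⟩ := exists_outer_moment_le n hσ2 hΛ hθ0.le (by linarith : θ < σ)
  obtain ⟨C₃, hC₃, hcut⟩ := exists_cutoff_moment_le n hσ2 hΛ
  set ω := (volume (ball (0 : E n) 1)).toReal with hω
  have hω0 : 0 < ω := ENNReal.toReal_pos (measure_ball_pos volume _ one_pos).ne'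
    measure_ball_lt_top.ne
  set c₀ := (2 - σ) * lam * μ * ω / 2 with hc₀
  have hc₀0 : 0 < c₀ := by positivity
  set cN := 1 + 1 / (2 * r) with hcN
  have hcN0 : 0 < cN := by positivity
  set D := 4 * (cN * C₁) + 4 * (1 / θ * 3 ^ θ * C₂) + 4 * C₃ + Mb with hD
  have hD0 : 0 ≤ D := by positivity
  set a := min θ (c₀ / (2 * (D + 1))) with ha
  have ha0 : 0 < a := by positivity
  have haθ : a ≤ θ := min_le_left _ _
  have ha1 : a ≤ 1 := by linarith
  have haD : a * D ≤ c₀ / 2 := by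
    have h1 : a * (2 * (D + 1)) ≤ c₀ := by
      rw [← le_div_iff₀ (by positivity)]; exact min_le_right _ _
    nlinarith
  set d₁ := min r (2 * r / C ^ 2 * (1 / 2) ^ (1 / a)) with hd₁
  refine ⟨a, d₁, c₀ / 2, ha0, by positivity, min_le_left _ _, by positivity, ?_⟩
  intro y w hd hdd₁ k hk S hSm hS hSvol hkS v hv hv0
  have hfd := hasFDerivAt_ballBarrier (a := a) hr hd
  refine ⟨hfd.differentiableAt, ?_⟩
  have hvpos : 0 < ‖w - y‖ := by linarith
  set ν := ‖w - y‖⁻¹ • (w - y) with hν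
  have hνnorm : ‖ν‖ = 1 := by
    rw [hν, norm_smul, norm_inv, norm_norm, inv_mul_cancel₀ hvpos.ne']
  have hnear := fun z => ballBarrier_near (z := z) hr ha0 ha1 σ hd
  have hfar := fun z => ballBarrier_far (w := w) (y := y) (r := r) (z := z) ha0 haθ hd
  have hinw := fun z => ballBarrier_inward (z := z) hr ha0 hd hC
  set d := ‖w - y‖ - r with hdef
  have hd1 : d < 1 := by linarith [min_le_left r (2 * r / C ^ 2 * (1 / 2) ^ (1 / a))]
  have hsmall : (C ^ 2 * d / (2 * r)) ^ a ≤ 1 / 2 := by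
    have h1 : d ≤ 2 * r / C ^ 2 * (1 / 2) ^ (1 / a) := hdd₁.le.trans (min_le_right _ _)
    have h2 : C ^ 2 * d / (2 * r) ≤ (1 / 2) ^ (1 / a) := by
      rw [div_le_iff₀ (by positivity)]
      calc C ^ 2 * d ≤ C ^ 2 * (2 * r / C ^ 2 * (1 / 2) ^ (1 / a)) :=
            mul_le_mul_of_nonneg_left h1 (by positivity)
        _ = _ := by field_simp
    refine (Real.rpow_le_rpow (by positivity) h2 ha0.le).trans_eq ?_
    rw [← Real.rpow_mul (by norm_num), one_div_mul_cancel ha0.ne', Real.rpow_one]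
  obtain ⟨N, hN1, hN2⟩ := exists_nat_pow_near_of_lt_one hd hd1.le (show (0 : ℝ) < 1 / 2 by norm_num)
    (by norm_num)
  set s : ℝ := (1 / 2) ^ (N + 1) with hs
  have hs0 : 0 < s := by positivity
  have hsd : d / 2 ≤ s := by rw [hs, pow_succ]; linarith
  obtain ⟨i1, b1⟩ := hin k hk s hs0
  obtain ⟨i2, b2⟩ := hout k hk s hs0
  obtain ⟨i3, b3⟩ := hcut k hk (N + 1)
  rw [← hs] at i3 b3
  obtain ⟨i4, b4⟩ := le_setIntegral_inward hσ0 hσ2 hΛ hlam hd hk hSm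
    (hS.trans inter_subset_right) hSvol hμ hkS
  set P := a * d ^ (a - 1) with hP
  have hP0 : 0 < P := by positivity
  set a₂ := a / θ * 3 ^ θ * d ^ (a - θ) with ha₂
  have ha₂0 : 0 < a₂ := by positivity
  set G₁ : E n → ℝ := fun z => P * cN * (‖z‖ ^ innerExp σ * k z) with hG₁
  set G₂ : E n → ℝ := fun z =>
    a₂ * (‖z‖ ^ θ * k z) - P * inner ℝ ν ((cutoff σ z * k z) • z) with hG₂
  set G₃ : E n → ℝ := fun z => d ^ a / 2 * k z with hG₃
  have j1 : IntegrableOn G₁ (ball 0 s) := i1.const_mul _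
  have j2' : IntegrableOn (fun z => inner ℝ ν ((cutoff σ z * k z) • z)) (ball 0 s)ᶜ :=
    i3.const_inner ν
  have j2 : IntegrableOn G₂ (ball 0 s)ᶜ := (i2.const_mul _).sub (j2'.const_mul _)
  have j3 : IntegrableOn G₃ S := i4.const_mul _
  have k1 : Integrable ((ball 0 s).indicator G₁) := (integrable_indicator_iff measurableSet_ball).2 j1
  have k2 : Integrable ((ball 0 s)ᶜ.indicator G₂) :=
    (integrable_indicator_iff measurableSet_ball.compl).2 j2
  have k3 : Integrable (S.indicator G₃) := (integrable_indicator_iff hSm).2 j3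
  have k12 : Integrable fun z => (ball 0 s).indicator G₁ z + (ball 0 s)ᶜ.indicator G₂ z := k1.add k2
  refine ⟨fun z => (ball 0 s).indicator G₁ z + (ball 0 s)ᶜ.indicator G₂ z - S.indicator G₃ z,
    k12.sub k3, fun z => ?_, ?_⟩
  · have hkz := hk.nonneg z
    beta_reduce
    by_cases hz : z ∈ ball (0 : E n) s
    · have hzs : ‖z‖ < s := mem_ball_zero_iff.1 hz
      have hzS : z ∉ S := fun h => (hS h).2.2 (mem_ball_zero_iff.2 (by linarith))
      rw [indicator_of_mem hz, indicator_of_notMem (by simpa using hz), indicator_of_notMem hzS]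
      have := mul_le_mul_of_nonneg_right (hnear z (by linarith) (by linarith)) hkz
      simp only [hG₁]
      linarith
    · have hzs : s ≤ ‖z‖ := by simpa using hz
      rw [indicator_of_notMem hz, indicator_of_mem (show z ∈ (ball (0 : E n) s)ᶜ from hz),
        increment_eq, hfd.fderiv]
      simp only [_root_.smul_apply, innerSL_apply_apply, smul_eq_mul, hG₂, real_inner_smul_right]
      have hpow : 0 ≤ a₂ * ‖z‖ ^ θ := by positivity
      by_cases hzS : z ∈ S
      · rw [indicator_of_mem hzS]
        have h1 := hinw z hsmall (hS hzS).1 (mem_ball_zero_iff.1 (hS hzS).2.1)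
        have h2 : ballBarrier y r a (w + z) - ballBarrier y r a w ≤ a₂ * ‖z‖ ^ θ - d ^ a / 2 := by
          linarith
        have h3 := mul_le_mul_of_nonneg_right h2 hkz
        simp only [hG₃]
        linarith
      · rw [indicator_of_notMem hzS]
        have h3 := mul_le_mul_of_nonneg_right (hfar z (by linarith)) hkz
        linarith
  · have hint : ∫ z, ((ball 0 s).indicator G₁ z + (ball 0 s)ᶜ.indicator G₂ z - S.indicator G₃ z) =
        P * cN * (∫ z in ball 0 s, ‖z‖ ^ innerExp σ * k z) +
        (a₂ * (∫ z in (ball 0 s)ᶜ, ‖z‖ ^ θ * k z) -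
          P * inner ℝ ν (∫ z in (ball 0 s)ᶜ, (cutoff σ z * k z) • z)) -
        d ^ a / 2 * ∫ z in S, k z := by
      rw [integral_sub k12 k3, integral_add k1 k2, integral_indicator measurableSet_ball,
        integral_indicator measurableSet_ball.compl, integral_indicator hSm, integral_const_mul,
        integral_const_mul, integral_sub (i2.const_mul _) (j2'.const_mul _), integral_const_mul,
        integral_const_mul, integral_inner i3]
    rw [hint, hfd.fderiv]
    simp only [_root_.smul_apply, innerSL_apply_apply, smul_eq_mul]
    set Q := d ^ (a - σ) with hQ
    have hQ1 : 1 ≤ Q := Real.one_le_rpow_of_pos_of_le_one_of_nonpos hd hd1.le (by linarith)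
    have q1 : |innerExp σ - σ| ≤ 2 := by
      rw [abs_of_pos (by linarith [lt_innerExp hσ2])]
      unfold innerExp; split_ifs <;> linarith
    have q2 : |θ - σ| ≤ 2 := by rw [abs_le]; constructor <;> linarith
    have q3 : |1 - σ| ≤ 2 := by rw [abs_le]; constructor <;> linarith
    have t1 : P * cN * (∫ z in ball 0 s, ‖z‖ ^ innerExp σ * k z) ≤ a * (4 * (cN * C₁)) * Q := by
      have h1 := rpow_le_four_mul hd hsd hN1.le q1
      have h2 : d ^ (a - 1) * d ^ (innerExp σ - σ) ≤ Q := by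
        rw [← Real.rpow_add hd, hQ]
        exact Real.rpow_le_rpow_of_exponent_ge hd hd1.le (by linarith [one_le_innerExp σ])
      calc P * cN * (∫ z in ball 0 s, ‖z‖ ^ innerExp σ * k z)
          ≤ P * cN * (C₁ * (4 * d ^ (innerExp σ - σ))) := by
            refine mul_le_mul_of_nonneg_left (b1.trans ?_) (by positivity)
            exact mul_le_mul_of_nonneg_left h1 hC₁
        _ = a * (4 * (cN * C₁)) * (d ^ (a - 1) * d ^ (innerExp σ - σ)) := by rw [hP]; ring
        _ ≤ _ := mul_le_mul_of_nonneg_left h2 (by positivity)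
    have t2 : a₂ * (∫ z in (ball 0 s)ᶜ, ‖z‖ ^ θ * k z) ≤
        a * (4 * (1 / θ * 3 ^ θ * C₂)) * Q := by
      have h1 := rpow_le_four_mul hd hsd hN1.le q2
      have h2 : d ^ (a - θ) * d ^ (θ - σ) = Q := by
        rw [← Real.rpow_add hd, hQ]; congr 1; ring
      calc a₂ * (∫ z in (ball 0 s)ᶜ, ‖z‖ ^ θ * k z)
          ≤ a₂ * (C₂ * (4 * d ^ (θ - σ))) := by
            refine mul_le_mul_of_nonneg_left (b2.trans ?_) ha₂0.le
            exact mul_le_mul_of_nonneg_left h1 hC₂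
        _ = a * (4 * (1 / θ * 3 ^ θ * C₂)) * (d ^ (a - θ) * d ^ (θ - σ)) := by rw [ha₂]; ring
        _ = _ := by rw [h2]
    have t3 : -(P * inner ℝ ν (∫ z in (ball 0 s)ᶜ, (cutoff σ z * k z) • z)) ≤
        a * (4 * C₃) * Q := by
      have h1 := rpow_le_four_mul hd hsd hN1.le q3
      have h2 : d ^ (a - 1) * d ^ (1 - σ) = Q := by
        rw [← Real.rpow_add hd, hQ]; congr 1; ring
      have h3 := abs_real_inner_le_norm ν (∫ z in (ball 0 s)ᶜ, (cutoff σ z * k z) • z)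
      rw [hνnorm, one_mul] at h3
      calc -(P * inner ℝ ν (∫ z in (ball 0 s)ᶜ, (cutoff σ z * k z) • z))
          = P * -(inner ℝ ν (∫ z in (ball 0 s)ᶜ, (cutoff σ z * k z) • z)) := by ring
        _ ≤ P * (C₃ * (4 * d ^ (1 - σ))) := by
            refine mul_le_mul_of_nonneg_left (((neg_le_abs _).trans h3).trans (b3.trans ?_)) hP0.le
            exact mul_le_mul_of_nonneg_left h1 hC₃
        _ = a * (4 * C₃) * (d ^ (a - 1) * d ^ (1 - σ)) := by rw [hP]; ring
        _ = _ := by rw [h2]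
    have t4 : c₀ * Q ≤ d ^ a / 2 * ∫ z in S, k z := by
      have h2 : d ^ a * d ^ (-σ) = Q := by
        rw [← Real.rpow_add hd, hQ]; congr 1
      calc c₀ * Q = d ^ a / 2 * ((2 - σ) * lam * μ * ω * d ^ (-σ)) := by rw [← h2, hc₀]; ring
        _ ≤ _ := mul_le_mul_of_nonneg_left b4 (by positivity)
    have t5 : -(a * Mb * Q) ≤ P * inner ℝ ν v := by
      rcases lt_or_ge σ 1 with h | h
      · rw [hv0 h, inner_zero_right, mul_zero, neg_nonpos]
        positivity
      · have h3 := abs_real_inner_le_norm ν v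
        rw [hνnorm, one_mul] at h3
        have h4 : -Mb ≤ inner ℝ ν v := by linarith [neg_abs_le (inner ℝ ν v)]
        have h5 : d ^ (a - 1) ≤ Q :=
          Real.rpow_le_rpow_of_exponent_ge hd hd1.le (by linarith)
        have h6 : P * Mb ≤ a * Mb * Q := by
          have := mul_le_mul_of_nonneg_left h5 (show 0 ≤ a * Mb by positivity)
          rw [hP]; linarith
        have h7 := mul_le_mul_of_nonneg_left h4 hP0.le
        linarith
    have hDQ : a * D * Q ≤ c₀ / 2 * Q := mul_le_mul_of_nonneg_right haD (by linarith)
    have hexp : a * D * Q = a * (4 * (cN * C₁)) * Q + a * (4 * (1 / θ * 3 ^ θ * C₂)) * Q +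
        a * (4 * C₃) * Q + a * Mb * Q := by rw [hD]; ring
    have hQc : c₀ / 2 ≤ c₀ / 2 * Q := le_mul_of_one_le_right (by positivity) hQ1
    have hQ2 : c₀ * Q = c₀ / 2 * Q + c₀ / 2 * Q := by ring
    rw [hexp] at hDQ
    clear_value c₀ Q P a₂ ν
    linarith only [t1, t2, t3, t4, t5, hDQ, hQc, hQ2]

end NonlocalIsaacs
namespace NonlocalIsaacs

/-! ### Barriers for the Dirichlet problem -/

section Barriers

variable {n : ℕ} {A B : Type*}

/-- At every point outside `Ω` there is a function that is positive elsewhere and is a strict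
supersolution of all the linear equations near its zero. -/
theorem exists_local_barrier {Ω : Set (E n)} (hΩ_open : IsOpen Ω)
    (hΩ_bdd : Bornology.IsBounded Ω) {ρ : ℝ} {y : E n → ℝ → E n} (hy : ExteriorBalls Ω ρ y)
    {σ Λ : ℝ} (hσ0 : 0 < σ) (hσ2 : σ < 2) (hΛ : 0 < Λ)
    {K : A → B → E n → E n → ℝ} {b : A → B → E n → E n}
    (hb_zero : σ < 1 → ∀ α β, ∀ x ∈ Ω, b α β x = 0)
    {Mb : ℝ} (hMb : ∀ α β, ∀ x ∈ Ω, ‖b α β x‖ ≤ Mb)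
    (hK : ∀ α β, ∀ x ∈ Ω, IsKernel σ Λ (K α β x))
    (hK_bdry : BoundaryNondegenerate σ Ω ρ y K) {x₀ : E n} (hx₀ : x₀ ∉ Ω) :
    ∃ H : E n → ℝ, Continuous H ∧ (∀ w, 0 ≤ H w) ∧ H x₀ = 0 ∧
      (∀ δ > 0, ∃ e > 0, ∀ w, δ ≤ ‖w - x₀‖ → e ≤ H w) ∧
      ∃ τ > 0, ∃ m > 0, ∀ w ∈ Ω, H w < τ → DifferentiableAt ℝ H w ∧
        ∀ α β, ∃ G : E n → ℝ, Integrable G ∧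
          (∀ z, increment σ H w z * K α β w z ≤ G z) ∧
          m ≤ -(∫ z, G z) + fderiv ℝ H w (b α β w) := by
  by_cases hcl : x₀ ∈ closure Ω
  swap
  · obtain ⟨τ, hτ, hball⟩ := Metric.mem_nhds_iff.1 (isClosed_closure.isOpen_compl.mem_nhds hcl)
    refine ⟨fun w => ‖w - x₀‖, by fun_prop, fun w => norm_nonneg _, by simp,
      fun δ hδ => ⟨δ, hδ, fun w hw => hw⟩, τ, hτ, 1, one_pos, fun w hw hwτ => ?_⟩
    exact absurd (subset_closure hw) (hball (by rwa [mem_ball, dist_eq_norm]))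
  have hfr : x₀ ∈ frontier Ω := by rw [frontier, hΩ_open.interior_eq]; exact ⟨hcl, hx₀⟩
  obtain ⟨C, r₁, lam, μ, hC, hr₁, hr₁ρ, hlam, hμ, hnd⟩ := hK_bdry
  set r := min (r₁ / 2) 1 with hr
  have hr0 : 0 < r := by positivity
  have hrr₁ : r < r₁ := (min_le_left _ _).trans_lt (by linarith)
  obtain ⟨-, htouch⟩ := hy x₀ hfr r hr0 (by linarith)
  obtain ⟨a, d₁, m, ha, hd₁, hd₁r, hm, hstrict⟩ := exists_ballBarrier_strict n hσ0 hσ2 hΛ hr0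
    (min_le_right _ _) hC hlam hμ (abs_nonneg Mb)
  set y₀ := y x₀ r with hy₀
  have hx₀y : ‖x₀ - y₀‖ ≤ r := by
    have : x₀ ∈ closedBall y₀ r ∩ closure Ω := by rw [htouch]; rfl
    simpa [dist_eq_norm] using this.1
  have hout : ∀ w ∈ Ω, 0 < ‖w - y₀‖ - r := by
    intro w hw
    by_contra! hle
    have : w ∈ closedBall y₀ r ∩ closure Ω :=
      ⟨by rw [mem_closedBall, dist_eq_norm]; linarith, subset_closure hw⟩
    rw [htouch, mem_singleton_iff] at this
    exact hx₀ (this ▸ hw)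
  obtain ⟨T, hT, hTq⟩ := exists_levyOp_le hσ0 hσ2 hΛ (contDiff_penalty x₀) (boundedFun_penalty x₀)
    hΩ_bdd
  set D := T + T * |Mb| with hD
  have hD0 : 0 ≤ D := by positivity
  set κ := m / (2 * (D + 1)) with hκ
  have hκ0 : 0 < κ := by positivity
  have hκD : κ * D ≤ m / 2 := by
    rw [hκ, div_mul_eq_mul_div, div_le_div_iff₀ (by positivity) (by positivity)]
    nlinarith
  refine ⟨fun w => ballBarrier y₀ r a w + κ * penalty x₀ w,
    (continuous_ballBarrier y₀ r ha.le).add (continuous_const.mul (contDiff_penalty x₀).continuous),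
    fun w => add_nonneg (ballBarrier_nonneg y₀ r a w) (mul_nonneg hκ0.le (penalty_nonneg x₀ w)),
    ?_, fun δ hδ => ⟨κ * (δ ^ 2 / (1 + δ ^ 2)), by positivity, fun w hw => ?_⟩,
    d₁ ^ a, by positivity, m / 2, by positivity, fun w hw hwτ => ?_⟩
  · beta_reduce
    rw [ballBarrier, max_eq_right (by linarith), Real.zero_rpow ha.ne']
    simp
  · have := mul_le_mul_of_nonneg_left (le_penalty hδ.le hw) hκ0.le
    linarith [ballBarrier_nonneg y₀ r a w]
  · have hd := hout w hw
    have hdd₁ : ‖w - y₀‖ - r < d₁ := by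
      by_contra! hle
      have h1 : d₁ ^ a ≤ ballBarrier y₀ r a w :=
        Real.rpow_le_rpow hd₁.le (hle.trans (le_max_left _ _)) ha.le
      linarith [mul_nonneg hκ0.le (penalty_nonneg x₀ w)]
    have hdq : DifferentiableAt ℝ (penalty x₀) w :=
      ((contDiff_penalty x₀).differentiable (by norm_num)) w
    have hdh : DifferentiableAt ℝ (ballBarrier y₀ r a) w :=
      (hasFDerivAt_ballBarrier hr0 hd).differentiableAt
    refine ⟨hdh.add (hdq.const_mul κ), fun α β => ?_⟩
    obtain ⟨S, hSm, hS, hSvol, hkS⟩ := hnd α β x₀ hfr r hr0 hrr₁ w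
      ⟨hw, by rw [mem_ball, dist_eq_norm]; linarith⟩
    have hk := hK α β w hw
    obtain ⟨-, G, hG, hGle, hGm⟩ := hstrict y₀ w hd hdd₁ _ hk S hSm hS hSvol hkS
      (b α β w) ((hMb α β w hw).trans (le_abs_self _)) (fun h => hb_zero h α β w hw)
    have hqi := integrable_increment_mul hσ0 hσ2 hΛ (contDiff_penalty x₀) (boundedFun_penalty x₀) w hk
    refine ⟨fun z => G z + κ * (increment σ (penalty x₀) w z * K α β w z),
      hG.add (hqi.const_mul κ), fun z => ?_, ?_⟩
    · rw [increment_add_mul σ hdh hdq]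
      linarith [hGle z]
    · rw [integral_add hG (hqi.const_mul κ), integral_const_mul, fderiv_fun_add hdh (hdq.const_mul κ),
        fderiv_const_mul hdq]
      simp only [_root_.add_apply, _root_.smul_apply, smul_eq_mul]
      obtain ⟨h1, h2⟩ := hTq w hw
      have h3 := (abs_le.1 (h2 _ hk)).2
      rw [levyOp] at h3
      have h4 : |fderiv ℝ (penalty x₀) w (b α β w)| ≤ T * |Mb| :=
        ((fderiv ℝ (penalty x₀) w).le_opNorm _).trans
          (mul_le_mul h1 ((hMb α β w hw).trans (le_abs_self _)) (norm_nonneg _) hT)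
      have h5 := (abs_le.1 h4).1
      have h6 : (∫ z, increment σ (penalty x₀) w z * K α β w z) -
          fderiv ℝ (penalty x₀) w (b α β w) ≤ D := by linarith
      have h7 := mul_le_mul_of_nonneg_left h6 hκ0.le
      linarith

/-- Upper barriers that majorise the datum everywhere and almost attain it at a given point. -/
theorem exists_upper_barrier {Ω : Set (E n)} (hΩ_open : IsOpen Ω)
    (hΩ_bdd : Bornology.IsBounded Ω) {ρ : ℝ} {y : E n → ℝ → E n} (hy : ExteriorBalls Ω ρ y)
    {g : E n → ℝ} (hg : Continuous g) {σ Λ γ : ℝ} (hσ0 : 0 < σ) (hσ2 : σ < 2) (hΛ : 0 < Λ)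
    {K : A → B → E n → E n → ℝ} {b : A → B → E n → E n} {c : A → B → E n → ℝ}
    (hb_zero : σ < 1 → ∀ α β, ∀ x ∈ Ω, b α β x = 0)
    (hc_coercive : ∀ α β, ∀ x ∈ Ω, γ ≤ c α β x)
    {Mb : ℝ} (hMb : ∀ α β, ∀ x ∈ Ω, ‖b α β x‖ ≤ Mb)
    {Mc : ℝ} (hMc : ∀ α β, ∀ x ∈ Ω, |c α β x| ≤ Mc)
    (hK : ∀ α β, ∀ x ∈ Ω, IsKernel σ Λ (K α β x))
    (hK_bdry : BoundaryNondegenerate σ Ω ρ y K)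
    {M Mf : ℝ} (hM : ∀ x, |g x| ≤ M) (hMf : 0 ≤ Mf) (hγM : Mf ≤ γ * M)
    {x₀ : E n} (hx₀ : x₀ ∉ Ω) {ε : ℝ} (hε : 0 < ε) :
    ∃ ψ : E n → ℝ, Continuous ψ ∧ (∀ x, |ψ x| ≤ M) ∧ (∀ x, g x ≤ ψ x) ∧ ψ x₀ ≤ g x₀ + ε ∧
      ∀ φ : E n → ℝ, ContDiff ℝ 2 φ → BoundedFun φ → ∀ w ∈ Ω,
        (∀ x, φ x - φ w ≤ ψ x - ψ w) → ∀ α β,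
          Mf ≤ -levyOp σ (K α β w) φ w + fderiv ℝ φ w (b α β w) + c α β w * ψ w := by
  obtain ⟨H, hHc, hH0, hHx₀, hHpos, τ, hτ, m, hm, hH⟩ :=
    exists_local_barrier hΩ_open hΩ_bdd hy hσ0 hσ2 hΛ hb_zero hMb hK hK_bdry hx₀
  have hM0 : 0 ≤ M := (abs_nonneg _).trans (hM x₀)
  obtain ⟨δ, hδ, hgδ⟩ := Metric.continuous_iff.1 hg x₀ ε hε
  obtain ⟨e, he, heH⟩ := hHpos δ hδ
  set Q := 2 * M / e + 2 * M / τ + (Mf + |Mc| * M) / m + 1 with hQ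
  have p1 : 0 ≤ 2 * M / e := by positivity
  have p2 : 0 ≤ 2 * M / τ := by positivity
  have p3 : 0 ≤ (Mf + |Mc| * M) / m := by positivity
  have hQ0 : 0 < Q := by linarith
  have hQe : 2 * M ≤ Q * e := by rw [← div_le_iff₀ he]; linarith
  have hQτ : 2 * M ≤ Q * τ := by rw [← div_le_iff₀ hτ]; linarith
  have hQm : Mf + |Mc| * M ≤ Q * m := by rw [← div_le_iff₀ hm]; linarith
  have hgx₀ := abs_le.1 (hM x₀)
  set ψ : E n → ℝ := fun x => min M (g x₀ + ε + Q * H x) with hψ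
  have hψc : Continuous ψ := continuous_const.min (continuous_const.add (continuous_const.mul hHc))
  have hψM : ∀ x, |ψ x| ≤ M := fun x => abs_le.2
    ⟨le_min (by linarith) (by nlinarith [mul_nonneg hQ0.le (hH0 x)]), min_le_left _ _⟩
  refine ⟨ψ, hψc, hψM, fun x => le_min (abs_le.1 (hM x)).2 ?_, ?_, ?_⟩
  · rcases lt_or_ge ‖x - x₀‖ δ with h | h
    · have h1 := hgδ x (by rwa [dist_eq_norm])
      rw [Real.dist_eq] at h1
      linarith [(abs_lt.1 h1).2, mul_nonneg hQ0.le (hH0 x)]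
    · have h1 := mul_le_mul_of_nonneg_left (heH x h) hQ0.le
      linarith [(abs_le.1 (hM x)).2]
  · refine (min_le_right _ _).trans ?_
    rw [hHx₀, mul_zero, add_zero]
  · intro φ hφ hφb w hw htouch α β
    have hk := hK α β w hw
    have dφ := (hφ.differentiable (by norm_num)) w
    have hφi := integrable_increment_mul hσ0 hσ2 hΛ hφ hφb w hk
    rcases le_or_gt M (g x₀ + ε + Q * H w) with hcase | hcase
    · have hψw : ψ w = M := min_eq_left hcase
      have hle : ∀ x, φ x - φ w ≤ (fun _ : E n => (0 : ℝ)) x - (fun _ : E n => (0 : ℝ)) w := by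
        intro x
        have h1 := htouch x
        have h2 : ψ x ≤ M := min_le_left _ _
        simp only [sub_zero]
        linarith
      have d0 : DifferentiableAt ℝ (fun _ : E n => (0 : ℝ)) w := differentiableAt_const _
      have h0 : ∀ z, increment σ (fun _ : E n => (0 : ℝ)) w z = 0 := fun z => by
        rw [increment_eq]; simp
      have hlevy : levyOp σ (K α β w) φ w ≤ 0 := by
        refine integral_nonpos fun z => ?_
        have := increment_le_increment σ dφ d0 hle z
        rw [h0] at this
        exact mul_nonpos_of_nonpos_of_nonneg this (hk.nonneg z)
      have hgrad : fderiv ℝ φ w = 0 := by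
        rw [fderiv_eq_of_sub_le dφ d0 (Eventually.of_forall hle)]
        simp
      rw [hgrad, hψw]
      have := mul_le_mul_of_nonneg_right (hc_coercive α β w hw) hM0
      simp only [_root_.zero_apply]
      linarith
    · have hψw : ψ w = g x₀ + ε + Q * H w := min_eq_right hcase.le
      have hHτ : H w < τ := by
        have : Q * H w < Q * τ := by linarith
        exact lt_of_mul_lt_mul_left this hQ0.le
      obtain ⟨dH, hG⟩ := hH w hw hHτ
      obtain ⟨G, hGi, hGle, hGm⟩ := hG α β
      have hle : ∀ x, φ x - φ w ≤ (fun x => Q * H x) x - (fun x => Q * H x) w := by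
        intro x
        have h1 := htouch x
        have h2 : ψ x ≤ g x₀ + ε + Q * H x := min_le_right _ _
        linarith
      have dQH : DifferentiableAt ℝ (fun x => Q * H x) w := dH.const_mul Q
      have hinc : ∀ z, increment σ (fun x => Q * H x) w z = Q * increment σ H w z := fun z => by
        rw [increment_eq, increment_eq, fderiv_const_mul dH]
        simp only [_root_.smul_apply, smul_eq_mul]
        ring
      have hlevy : levyOp σ (K α β w) φ w ≤ Q * ∫ z, G z := by
        rw [← integral_const_mul]
        refine integral_mono hφi (hGi.const_mul Q) fun z => ?_
        have h1 := mul_le_mul_of_nonneg_right (increment_le_increment σ dφ dQH hle z) (hk.nonneg z)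
        rw [hinc] at h1
        have h2 := mul_le_mul_of_nonneg_left (hGle z) hQ0.le
        simp only
        linarith
      have hgrad : fderiv ℝ φ w (b α β w) = Q * fderiv ℝ H w (b α β w) := by
        rw [fderiv_eq_of_sub_le dφ dQH (Eventually.of_forall hle), fderiv_const_mul dH]
        simp
      rw [hgrad]
      have h3 := mul_le_mul_of_nonneg_left hGm hQ0.le
      have h4 : |c α β w * ψ w| ≤ |Mc| * M := by
        rw [abs_mul]
        exact mul_le_mul ((hMc α β w hw).trans (le_abs_self _)) (hψM w) (abs_nonneg _)
          (abs_nonneg _)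
      have h5 := (abs_le.1 h4).1
      linarith

lemma levyOp_neg (σ : ℝ) (k : E n → ℝ) (φ : E n → ℝ) (x : E n) :
    levyOp σ k (fun y => -φ y) x = -levyOp σ k φ x := by
  rw [levyOp, levyOp, ← integral_neg]
  congr 1
  ext z
  rw [increment_eq, increment_eq, fderiv_fun_neg]
  simp only [_root_.neg_apply]
  ring

end Barriers

end NonlocalIsaacs

theorem theorem5p12 {n : ℕ} (hn : 1 ≤ n) {A B : Type*} [Nonempty A] [Nonempty B]
    -- the domain, with the uniform exterior ball condition
    (Ω : Set (E n)) (hΩ_open : IsOpen Ω) (hΩ_bdd : Bornology.IsBounded Ω)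
    (ρ : ℝ) (hρ : 0 < ρ) (y : E n → ℝ → E n) (hy : ExteriorBalls Ω ρ y)
    -- the exterior datum
    (g : E n → ℝ) (hg : Continuous g) (hg_bdd : BoundedFun g)
    -- the coefficients
    (σ Λ γ : ℝ) (hσ0 : 0 < σ) (hσ2 : σ < 2) (hΛ : 0 < Λ) (hγ : 0 < γ)
    (K : A → B → E n → E n → ℝ) (b : A → B → E n → E n) (c f : A → B → E n → ℝ)
    (hb_zero : σ < 1 → ∀ α β, ∀ x ∈ Ω, b α β x = 0)
    (hc_coercive : ∀ α β, ∀ x ∈ Ω, γ ≤ c α β x)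
    -- boundedness in `Ω`, uniform in the indices (and, for the kernels, in `z` on annuli)
    (hK_bdd : ∀ s R : ℝ, 0 < s → s < R →
      ∃ M : ℝ, ∀ α β, ∀ x ∈ Ω, ∀ z : E n, s ≤ ‖z‖ → ‖z‖ ≤ R → K α β x z ≤ M)
    (hb_bdd : ∃ M : ℝ, ∀ α β, ∀ x ∈ Ω, ‖b α β x‖ ≤ M)
    (hc_bdd : ∃ M : ℝ, ∀ α β, ∀ x ∈ Ω, |c α β x| ≤ M)
    (hf_bdd : ∃ M : ℝ, ∀ α β, ∀ x ∈ Ω, |f α β x| ≤ M)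
    -- continuity in `Ω`, uniform in the indices
    (hK_cont : ∀ z : E n, z ≠ 0 →
      EquicontinuousOn (fun (p : A × B) (x : E n) => K p.1 p.2 x z) Ω)
    (hb_cont : EquicontinuousOn (fun p : A × B => b p.1 p.2) Ω)
    (hc_cont : EquicontinuousOn (fun p : A × B => c p.1 p.2) Ω)
    (hf_cont : EquicontinuousOn (fun p : A × B => f p.1 p.2) Ω)
    -- structure of the kernels
    (hK : ∀ α β, ∀ x ∈ Ω, IsKernel σ Λ (K α β x))
    (hK_bdry : BoundaryNondegenerate σ Ω ρ y K) :
    ∃ u : E n → ℝ, IsDiscontinuousViscositySolution (isaacsOp σ K b c f) Ω g u := by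
  have : Nonempty (Fin n) := ⟨⟨0, hn⟩⟩
  have hell := isEllipticOn_isaacsOp hΩ_bdd hσ0 hσ2 hΛ hK_bdd hb_bdd hc_bdd hf_bdd hK_cont hb_cont
    hc_cont hf_cont hK
  obtain ⟨Mg, hMg⟩ := hg_bdd
  obtain ⟨Mb, hMb⟩ := hb_bdd
  obtain ⟨Mc, hMc⟩ := hc_bdd
  obtain ⟨Mf, hMf⟩ := hf_bdd
  set M := |Mg| + |Mf| / γ with hM
  have hgM : ∀ x, |g x| ≤ M := fun x => by
    have : 0 ≤ |Mf| / γ := by positivity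
    linarith [hMg x, le_abs_self Mg]
  have hγM : |Mf| ≤ γ * M := by
    have : γ * (|Mf| / γ) = |Mf| := by field_simp
    have h2 : 0 ≤ γ * |Mg| := by positivity
    rw [hM, mul_add]
    linarith
  have hf' : ∀ α β, ∀ x ∈ Ω, |f α β x| ≤ |Mf| := fun α β x hx =>
    (hMf α β x hx).trans (le_abs_self _)
  have hne : ∃ x₀, x₀ ∉ Ω := by
    by_contra! h
    exact NormedSpace.unbounded_univ ℝ (E n) (hΩ_bdd.subset fun x _ => h x)
  set Ψ : Set (E n → ℝ) := {ψ | Continuous ψ ∧ (∀ x, |ψ x| ≤ M) ∧ (∀ x, g x ≤ ψ x) ∧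
    IsViscositySupersolution (isaacsOp σ K b c f) Ω ψ} with hΨ
  set Φ : Set (E n → ℝ) := {φ | Continuous φ ∧ (∀ x, |φ x| ≤ M) ∧ (∀ x, φ x ≤ g x) ∧
    IsViscositySubsolution (isaacsOp σ K b c f) Ω φ} with hΦ
  have hΨg : ∀ x ∈ Ωᶜ, ∀ ε > 0, ∃ ψ ∈ Ψ, ψ x ≤ g x + ε := by
    intro x₀ hx₀ ε hε
    obtain ⟨ψ, hc, hb, hge, hψx₀, hψ⟩ := exists_upper_barrier hΩ_open hΩ_bdd hy hg hσ0 hσ2 hΛ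
      hb_zero hc_coercive hMb hMc hK hK_bdry hgM (abs_nonneg Mf) hγM hx₀ hε
    refine ⟨ψ, ⟨hc, hb, hge, ⟨M, hb⟩, hc.lowerSemicontinuous, fun φ hφ hφb w hw hmin => ?_⟩, hψx₀⟩
    refine Real.iSup_nonneg fun α => Real.iInf_nonneg fun β => ?_
    have h1 := hψ φ hφ hφb w hw (fun x => by linarith [hmin x]) α β
    linarith [(abs_le.1 (hf' α β w hw)).1]
  have hΦg : ∀ x ∈ Ωᶜ, ∀ ε > 0, ∃ φ ∈ Φ, g x - ε ≤ φ x := by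
    intro x₀ hx₀ ε hε
    obtain ⟨ψ, hc, hb, hge, hψx₀, hψ⟩ := exists_upper_barrier hΩ_open hΩ_bdd hy hg.neg hσ0 hσ2 hΛ
      hb_zero hc_coercive hMb hMc hK hK_bdry (by simpa using hgM) (abs_nonneg Mf) hγM hx₀ hε
    simp only [Pi.neg_apply] at hge hψx₀
    have hb' : ∀ x, |-ψ x| ≤ M := by simpa using hb
    refine ⟨fun x => -ψ x, ⟨hc.neg, hb', fun x => by
        simp only; linarith [hge x], ⟨M, hb'⟩,
      hc.neg.upperSemicontinuous, fun φ hφ hφb w hw hmax => ?_⟩, by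
        simp only; linarith⟩
    refine Real.iSup_nonpos fun α => Real.iInf_nonpos fun β => ?_
    have h1 := hψ _ hφ.neg hφb.neg w hw (fun x => by linarith [hmax x]) α β
    rw [levyOp_neg, fderiv_fun_neg] at h1
    simp only [_root_.neg_apply] at h1
    linarith [(abs_le.1 (hf' α β w hw)).2]
  obtain ⟨x₀, hx₀⟩ := hne
  obtain ⟨ψ₀, hψ₀, -⟩ := hΨg x₀ hx₀ 1 one_pos
  obtain ⟨φ₀, hφ₀, -⟩ := hΦg x₀ hx₀ 1 one_pos
  exact exists_discontinuousViscositySolution hΩ_open hell ⟨φ₀, hφ₀⟩ ⟨ψ₀, hψ₀⟩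
    (fun φ hφ => hφ.2.1) (fun ψ hψ => hψ.2.1) (fun φ hφ => hφ.1) (fun ψ hψ => hψ.1)
    (fun φ hφ => hφ.2.2.2) (fun ψ hψ => hψ.2.2.2)
    (fun φ hφ ψ hψ x => (hφ.2.2.1 x).trans (hψ.2.2.1 x)) hΦg hΨg
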